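/- Let $\mathbb{BC}=\{w_1+jw_2 : w_1,w_2\in\mathbb C\}$, $j^2=-1$, $ij=ji=k$, be the bicomplex numbers. With $e_1=\frac{1+k}{2}$, $e_2=\frac{1-k}{2}$, every $W=w_1+jw_2$ is written $W=W_1e_1+W_2e_2$, where $W_1=w_1-iw_2$ and $W_2=w_1+iw_2$, and sums and products are formed componentwise. Put $\Gamma(Y)=\Gamma(y_1)e_1+\Gamma(y_2)e_2$ and $\operatorname{Log}W=\operatorname{Log}W_1\,e_1+\operatorname{Log}W_2\,e_2$ (principal logarithms), with $1/\Gamma=0$ at a pole of $\Gamma$ in either component. Let $\mathcal V,\ C=c_1e_1+c_2e_2,\ Z=z_1e_1+z_2e_2\in\mathbb{BC}$ with $\Re(c_1z_1)<0$ and $\Re(c_2z_2)<0$. Let $\log Z$ and $\log(-C)$ be bicomplex logarithms of $Z$ and of $-C$ (so $e^{\log Z}=Z$ and $e^{\log(-C)}=-C$), with branches compatible in the sense that $\log(-C)+\log Z=\operatorname{Log}(-CZ)$, and put $Z^{S}=e^{S\log Z}$, $(-C)^{S}=e^{S\log(-C)}$. Let $$E_{\mathcal V,C}(Z)=Z^{\mathcal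 V}\sum_{r=0}^{\infty}\frac{(CZ)^r}{\Gamma(\mathcal V+r+1)}$$ be the bicomplex Miller-Ross function. A Barnes path is a continuous, piecewise continuously differentiable path $\gamma:\mathbb R\to\mathbb C$ with bounded real part, with $\Im\gamma(t)\to\pm\infty$ as $t\to\pm\infty$, such that the poles $0,1,2,\dots$ of $\Gamma(-s)$ lie to the right of $\gamma$ and the poles $-1,-2,\dots$ of $\Gamma(1+s)$ lie to the left of $\gamma$ (a point lies to the left, respectively right, of $\gamma$ if it can be joined in $\mathbb C\setminus\gamma(\mathbb R)$ to all real points sufficiently far to the left, respectively right). Let $\Omega=\Omega_1e_1+\Omega_2e_2:\mathbb R\to\mathbb{BC}$ be a path whose components $\Omega_1,\Omega_2$ are Barnes paths. Then $$\int_\Omega\frac{(-C)^sZ^{\mathcal V+s}\,\Gamma(-s)\,\Gamma(1+s)}{\Gamma(\mathcal V+1+s)}\,ds=2\pi i\,E_{\mathcal V,C}(Z),$$ where the integral is the limit of $\int_a^b f(\Omega(t))\,\Omega'(t)\,dt$ ($f$ being the integrand) as $a\to-\infty$, $b\to+\infty$ independently, and this limit exists. -/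

import Mathlib

open Filter Topology
open scoped Real

noncomputable section

/-- The bicomplex numbers `w₁ + j w₂` with `w₁, w₂ ∈ ℂ(i)` and `j ^ 2 = -1`: here `w₁ = re`
and `w₂ = im`. -/
abbrev Bicomplex : Type := QuadraticAlgebra ℂ (-1) 0

namespace Bicomplex

@[simp] theorem re_one : (1 : Bicomplex).re = 1 := rfl

@[simp] theorem im_one : (1 : Bicomplex).im = 0 := rfl

/-- The first idempotent component `z₁ = w₁ - i w₂` of `w₁ + j w₂`. -/
def proj₁ : Bicomplex →ₐ[ℂ] ℂ where
  toFun W := W.re - Complex.I * W.im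
  map_one' := by simp
  map_mul' W W' := by
    simp only [QuadraticAlgebra.re_mul, QuadraticAlgebra.im_mul]
    linear_combination (-(W.im * W'.im)) * Complex.I_sq
  map_zero' := by simp
  map_add' W W' := by
    simp only [QuadraticAlgebra.re_add, QuadraticAlgebra.im_add]
    ring
  commutes' a := by simp

/-- The second idempotent component `z₂ = w₁ + i w₂` of `w₁ + j w₂`. -/
def proj₂ : Bicomplex →ₐ[ℂ] ℂ where
  toFun W := W.re + Complex.I * W.im
  map_one' := by simp
  map_mul' W W' := by
    simp only [QuadraticAlgebra.re_mul, QuadraticAlgebra.im_mul]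
    linear_combination (-(W.im * W'.im)) * Complex.I_sq
  map_zero' := by simp
  map_add' W W' := by
    simp only [QuadraticAlgebra.re_add, QuadraticAlgebra.im_add]
    ring
  commutes' a := by simp

/-- The imaginary unit `j`. -/
def j : Bicomplex := ⟨0, 1⟩

/-- The hyperbolic unit `k = i j`. -/
def k : Bicomplex := Complex.I • j

/-- The idempotent `e₁ = (1 + k) / 2`. -/
def e₁ : Bicomplex := (1 / 2 : ℂ) • (1 + k)

/-- The idempotent `e₂ = (1 - k) / 2`. -/
def e₂ : Bicomplex := (1 / 2 : ℂ) • (1 - k)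

/-- The bicomplex number `z₁ e₁ + z₂ e₂`. -/
def ofIdem (z₁ z₂ : ℂ) : Bicomplex := z₁ • e₁ + z₂ • e₂

theorem proj₁_ofIdem (z₁ z₂ : ℂ) : proj₁ (ofIdem z₁ z₂) = z₁ := by
  simp [proj₁, ofIdem, e₁, e₂, k, j]
  linear_combination ((z₂ - z₁) / 2) * Complex.I_sq

theorem proj₂_ofIdem (z₁ z₂ : ℂ) : proj₂ (ofIdem z₁ z₂) = z₂ := by
  simp [proj₂, ofIdem, e₁, e₂, k, j]
  linear_combination ((z₁ - z₂) / 2) * Complex.I_sq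

theorem ofIdem_proj (W : Bicomplex) : ofIdem (proj₁ W) (proj₂ W) = W := by
  ext
  · simp [proj₁, proj₂, ofIdem, e₁, e₂, k, j]
    ring
  · simp [proj₁, proj₂, ofIdem, e₁, e₂, k, j]
    linear_combination (-W.im) * Complex.I_sq

/-- The pair of idempotent components. -/
def toProd : Bicomplex →ₐ[ℂ] ℂ × ℂ := proj₁.prod proj₂

theorem toProd_injective : Function.Injective toProd := by
  intro W W' h
  have h1 : proj₁ W = proj₁ W' := congrArg Prod.fst h
  have h2 : proj₂ W = proj₂ W' := congrArg Prod.snd h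
  rw [← ofIdem_proj W, ← ofIdem_proj W', h1, h2]

/-- Bicomplex numbers carry the norm `max |z₁| |z₂|`. It is equivalent to the Euclidean norm of
`ℝ⁴` and only serves to give the usual topology (limits, derivatives of curves, integrals). -/
instance : NormedCommRing Bicomplex := NormedCommRing.induced Bicomplex (ℂ × ℂ) toProd
  toProd_injective

instance : NormedSpace ℂ Bicomplex := NormedSpace.induced ℂ Bicomplex (ℂ × ℂ) toProd.toLinearMap

instance : NormedSpace ℝ Bicomplex where
  norm_smul_le r W := by
    have h : r • W = (r : ℂ) • W := by ext <;> simp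
    rw [h]
    simpa using norm_smul_le (r : ℂ) W

/-- The inverse `z₁⁻¹ e₁ + z₂⁻¹ e₂`, with the convention `0⁻¹ = 0` in each component. -/
instance : Inv Bicomplex := ⟨fun W => ofIdem (proj₁ W)⁻¹ (proj₂ W)⁻¹⟩

theorem mul_inv_cancel_of_ne {W : Bicomplex} (h₁ : proj₁ W ≠ 0) (h₂ : proj₂ W ≠ 0) :
    W * W⁻¹ = 1 := by
  apply toProd_injective
  have e : W⁻¹ = ofIdem (proj₁ W)⁻¹ (proj₂ W)⁻¹ := rfl
  rw [e]
  refine Prod.ext ?_ ?_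
  · change proj₁ (W * _) = proj₁ 1
    rw [map_mul, proj₁_ofIdem, map_one, mul_inv_cancel₀ h₁]
  · change proj₂ (W * _) = proj₂ 1
    rw [map_mul, proj₂_ofIdem, map_one, mul_inv_cancel₀ h₂]

/-- The bicomplex gamma function `Γ(y₁) e₁ + Γ(y₂) e₂`. Mathlib's `Complex.Gamma` is `0` at its
poles, so that `(Gamma Y)⁻¹` has the conventional value `1 / Γ = 0` in a component at a pole. -/
def Gamma (Y : Bicomplex) : Bicomplex :=
  ofIdem (Complex.Gamma (proj₁ Y)) (Complex.Gamma (proj₂ Y))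

/-- The principal bicomplex logarithm `Log z₁ e₁ + Log z₂ e₂`. -/
def log (W : Bicomplex) : Bicomplex := ofIdem (Complex.log (proj₁ W)) (Complex.log (proj₂ W))

/-- The power `W ^ S = exp (S L)` for the branch `L` of the logarithm of `W`
(that is, `exp L = W`). -/
def powOfLog (L S : Bicomplex) : Bicomplex := NormedSpace.exp (S * L)

/-- The Miller-Ross function `E_{V,C}(Z) = Z ^ V ∑ (C Z) ^ r / Γ(V + r + 1)`, where the power
`Z ^ V` is taken for the branch `L` of the logarithm of `Z`. -/
def millerRoss (L V C Z : Bicomplex) : Bicomplex :=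
  powOfLog L V * ∑' r : ℕ, (C * Z) ^ r * (Gamma (V + (r : Bicomplex) + 1))⁻¹

/-- The improper integral of `f` along the curve `ξ`, parametrised by `ℝ`, converges to `J`. -/
def HasPathIntegral (f : Bicomplex → Bicomplex) (ξ : ℝ → Bicomplex) (J : Bicomplex) : Prop :=
  Tendsto (fun p : ℝ × ℝ => ∫ t in p.1..p.2, f (ξ t) * deriv ξ t) (atBot ×ˢ atTop) (𝓝 J)

end Bicomplex

/-- `γ` is piecewise continuously differentiable: it is continuous, and there is a locally finite
set of break points such that `γ` is `C¹` on every compact interval without break point in its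
interior (so with one-sided derivatives at the ends). -/
def IsPiecewiseC1 (γ : ℝ → ℂ) : Prop :=
  Continuous γ ∧ ∃ B : Set ℝ, (∀ a b : ℝ, (B ∩ Set.Icc a b).Finite) ∧
    ∀ a b : ℝ, a < b → Disjoint B (Set.Ioo a b) → ContDiffOn ℝ 1 γ (Set.Icc a b)

/-- For an upward path `γ` of bounded real part: `p` lies to the left of `γ`, in the same
component of the complement of `γ` as all points far to the left on the real axis. -/
def LiesLeftOf (p : ℂ) (γ : ℝ → ℂ) : Prop :=
  ∀ᶠ x : ℝ in atBot, JoinedIn (Set.range γ)ᶜ p (x : ℂ)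

/-- For an upward path `γ` of bounded real part: `p` lies to the right of `γ`. -/
def LiesRightOf (p : ℂ) (γ : ℝ → ℂ) : Prop :=
  ∀ᶠ x : ℝ in atTop, JoinedIn (Set.range γ)ᶜ p (x : ℂ)

/-- Barnes paths for `Γ(-s) Γ(1 + s)`: piecewise continuously differentiable paths from `-i∞` to
`+i∞` inside a vertical strip, with the poles `0, 1, 2, …` of `Γ(-s)` on the right and the poles
`-1, -2, …` of `Γ(1 + s)` on the left. -/
structure IsBarnesPath (γ : ℝ → ℂ) : Prop where
  piecewiseC1 : IsPiecewiseC1 γ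
  bounded_re : ∃ M : ℝ, ∀ t, |(γ t).re| ≤ M
  tendsto_bot : Tendsto (fun t => (γ t).im) atBot atBot
  tendsto_top : Tendsto (fun t => (γ t).im) atTop atTop
  right_poles : ∀ r : ℕ, LiesRightOf (r : ℂ) γ
  left_poles : ∀ l : ℕ, 1 ≤ l → LiesLeftOf (-(l : ℂ)) γ

end

/-! The claim splits along the idempotents: `hasPathIntegral_of_proj` and `millerRoss_eq_ofIdem`
leave one complex integral per component. There Γ(-s)Γ(1+s) = -π/sin(πs), and the branch condition
merges the two powers into e^{v log z} x^s with the principal power of x = -cz, Re x > 0. So the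
task is to integrate g(s) π/sin(πs) for the entire function g(s) = x^s/Γ(v+1+s). Its residue at n is
(-1)^n g(n), and the poles n ≥ 0 lie to the right of an upward path, so the value is -2πi ∑ (-1)^n
g(n).

A Barnes path may wander and cross itself, so no contour is closed. On the strip |Re s| < N+1 the
function minus its principal parts has a primitive, to which
`exists_primitive_and_eventually_integral_eq` adds the terms log(s-n). Topology enters only through
∫ dz/(z-n): the pole can be moved off the path to a distant real point, where log(±(z-p)) is a
primitive along the whole path (`integral_inv_sub_of_path`). The two signs differ by 2πi per pole on
the right. `tendsto_integral_mul_pi_div_sin` then compares the ends of the path with the line Re s =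
N+1/2.

Convergence is a matter of growth. On strips x^s is O(e^{|arg x||Im s|}) and 1/Γ is O(e^{(π-φ)|Im
s|}) for each 0 ≤ φ < π/2, while 1/sin(πs) contributes e^{-π|Im s|}. Since |arg x| < π/2, an
exponential decay remains. On Re s = N+1/2 a further factor of the form |x|^m/m! tends to 0 with N.
-/

/-! ### Calculus along piecewise C¹ paths -/

/-- Each point has a one-sided neighbourhood on which `γ` is `C¹`, up to the point itself. -/
theorem IsPiecewiseC1.exists_contDiffOn {γ : ℝ → ℂ} (h : IsPiecewiseC1 γ) :
    ∃ B : Set ℝ, B.Countable ∧ (∀ t ∉ B, DifferentiableAt ℝ γ t) ∧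
      ∀ t, ∃ ε > 0, ContDiffOn ℝ 1 γ (Set.Icc (t - ε) t) ∧ ContDiffOn ℝ 1 γ (Set.Icc t (t + ε)) := by
  obtain ⟨hc, B, hB, hC⟩ := h
  have key : ∀ t, ∃ ε > 0, ∀ s ∈ B, |s - t| < ε → s = t := by
    intro t
    have hfin : (B ∩ Set.Icc (t - 1) (t + 1)).Finite := hB _ _
    have hcl : IsClosed ((B ∩ Set.Icc (t - 1) (t + 1)) \ {t}) := (hfin.subset Set.sdiff_subset).isClosed
    have hn : ((B ∩ Set.Icc (t - 1) (t + 1)) \ {t})ᶜ ∈ 𝓝 t := hcl.isOpen_compl.mem_nhds (by simp)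
    obtain ⟨ε, hε, hb⟩ := Metric.mem_nhds_iff.1 hn
    refine ⟨min ε 1, by positivity, fun s hs hst => ?_⟩
    by_contra hne
    have h1 : s ∈ Metric.ball t ε := by
      rw [Metric.mem_ball, Real.dist_eq]; exact hst.trans_le (min_le_left _ _)
    have h2 := hst.trans_le (min_le_right _ _)
    rw [abs_lt] at h2
    exact hb h1 ⟨⟨hs, by constructor <;> linarith⟩, hne⟩
  refine ⟨B, ?_, ?_, ?_⟩
  · have : B = ⋃ n : ℕ, B ∩ Set.Icc (-(n : ℝ)) n := by
      ext x
      simp only [Set.mem_iUnion, Set.mem_inter_iff, Set.mem_Icc]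
      constructor
      · intro hx
        obtain ⟨n, hn⟩ := exists_nat_ge |x|
        exact ⟨n, hx, by linarith [neg_abs_le x], by linarith [le_abs_self x]⟩
      · rintro ⟨n, hx, -⟩
        exact hx
    rw [this]
    exact Set.countable_iUnion fun n => (hB _ _).countable
  · intro t ht
    obtain ⟨ε, hε, he⟩ := key t
    have hd : Disjoint B (Set.Ioo (t - ε) (t + ε)) := by
      rw [Set.disjoint_left]
      rintro s hs ⟨h1, h2⟩
      exact ht (he s hs (abs_lt.2 ⟨by linarith, by linarith⟩) ▸ hs)
    exact ((hC _ _ (by linarith) hd).differentiableOn one_ne_zero).differentiableAt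
      (Icc_mem_nhds (by linarith) (by linarith))
  · intro t
    obtain ⟨ε, hε, he⟩ := key t
    refine ⟨ε, hε, hC _ _ (by linarith) ?_, hC _ _ (by linarith) ?_⟩ <;>
    · rw [Set.disjoint_left]
      rintro s hs ⟨h1, h2⟩
      have := he s hs (abs_lt.2 ⟨by linarith, by linarith⟩)
      linarith

/-- The one-sided derivative is continuous on the closed interval and agrees with `deriv` inside;
the two endpoints, where `deriv` may be a default value, are null. -/
theorem ContDiffOn.integrableOn_deriv_Icc {γ : ℝ → ℂ} {a b : ℝ} (hab : a < b)
    (h : ContDiffOn ℝ 1 γ (Set.Icc a b)) :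
    MeasureTheory.IntegrableOn (deriv γ) (Set.Icc a b) := by
  have hcont : ContinuousOn (derivWithin γ (Set.Icc a b)) (Set.Icc a b) :=
    h.continuousOn_derivWithin (uniqueDiffOn_Icc hab) le_rfl
  have h1 := (hcont.integrableOn_Icc (μ := MeasureTheory.volume)).mono_set Set.Ioo_subset_Icc_self
  rw [integrableOn_Icc_iff_integrableOn_Ioo]
  refine h1.congr_fun (fun t ht => ?_) measurableSet_Ioo
  exact derivWithin_of_mem_nhds (Icc_mem_nhds ht.1 ht.2)

theorem IsPiecewiseC1.intervalIntegrable_deriv {γ : ℝ → ℂ} (h : IsPiecewiseC1 γ) (a b : ℝ) :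
    IntervalIntegrable (deriv γ) MeasureTheory.volume a b := by
  obtain ⟨B, -, -, hC⟩ := h.exists_contDiffOn
  have : MeasureTheory.LocallyIntegrable (deriv γ) MeasureTheory.volume := by
    intro t
    obtain ⟨ε, hε, h1, h2⟩ := hC t
    refine ⟨Set.Icc (t - ε) t ∪ Set.Icc t (t + ε), ?_, ?_⟩
    · rw [Set.Icc_union_Icc_eq_Icc (by linarith) (by linarith)]
      exact Icc_mem_nhds (by linarith) (by linarith)
    · exact (h1.integrableOn_deriv_Icc (by linarith)).union (h2.integrableOn_deriv_Icc (by linarith))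
  exact intervalIntegrable_iff.2
    ((this.integrableOn_isCompact isCompact_uIcc).mono_set Set.uIoc_subset_uIcc)

theorem IsPiecewiseC1.intervalIntegrable_comp_mul_deriv {γ : ℝ → ℂ} (h : IsPiecewiseC1 γ)
    {f : ℂ → ℂ} {a b : ℝ} (hf : ContinuousOn (fun t => f (γ t)) (Set.uIcc a b)) :
    IntervalIntegrable (fun t => f (γ t) * deriv γ t) MeasureTheory.volume a b :=
  (h.intervalIntegrable_deriv a b).continuousOn_mul hf

/-- The fundamental theorem of calculus along a piecewise `C¹` path. -/
theorem IsPiecewiseC1.integral_comp_mul_deriv {γ : ℝ → ℂ} (h : IsPiecewiseC1 γ)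
    {F f : ℂ → ℂ} {a b : ℝ} (hF : ∀ t ∈ Set.uIcc a b, HasDerivAt F (f (γ t)) (γ t))
    (hf : ContinuousOn (fun t => f (γ t)) (Set.uIcc a b)) :
    ∫ t in a..b, f (γ t) * deriv γ t = F (γ b) - F (γ a) := by
  obtain ⟨B, hB, hd, -⟩ := h.exists_contDiffOn
  -- At the countably many break points only continuity of `F ∘ γ` is needed.
  refine MeasureTheory.integral_eq_of_hasDerivAt_off_countable (fun t => F (γ t)) _ hB ?_ ?_
    (h.intervalIntegrable_comp_mul_deriv hf)
  · exact fun t ht => ((hF t ht).continuousAt.comp (h.1.continuousAt)).continuousWithinAt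
  · exact fun t ht => (hF t (Set.Ioo_subset_Icc_self ht.1)).comp t (hd t ht.2).hasDerivAt

/-! ### Integrals of 1/(z - p) and the side on which p lies -/

/-- `∫ dz / (z - p)` along a path, when a local primitive `log (u (z - p))` is defined. -/
theorem IsPiecewiseC1.integral_inv_sub_of_slitPlane {γ : ℝ → ℂ} (h : IsPiecewiseC1 γ) {p u : ℂ}
    (hu : u ≠ 0) {a b : ℝ} (hs : ∀ t ∈ Set.uIcc a b, u * (γ t - p) ∈ Complex.slitPlane) :
    ∫ t in a..b, (γ t - p)⁻¹ * deriv γ t =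
      Complex.log (u * (γ b - p)) - Complex.log (u * (γ a - p)) := by
  have hne : ∀ t ∈ Set.uIcc a b, γ t - p ≠ 0 := fun t ht h0 => by
    have := hs t ht
    simp [h0] at this
  refine h.integral_comp_mul_deriv (F := fun z => Complex.log (u * (z - p)))
    (f := fun z => (z - p)⁻¹) (fun t ht => ?_) ?_
  · have := (((hasDerivAt_id (γ t)).sub_const p).const_mul u).clog (hs t ht)
    convert! this using 1
    have := hne t ht
    simp
    field_simp
  · exact (h.1.continuousOn.sub continuousOn_const).inv₀ hne

theorem Complex.log_sub_log_eq_log_div {z w : ℂ} (hz : z ≠ 0) (hw : w ≠ 0)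
    (h : z.arg - w.arg ∈ Set.Ioc (-π) π) : Complex.log (z / w) = Complex.log z - Complex.log w := by
  have e : Complex.exp (Complex.log z - Complex.log w) = z / w := by
    rw [Complex.exp_sub, Complex.exp_log hz, Complex.exp_log hw]
  rw [← e, Complex.log_exp] <;> simp [Complex.log_im, h.1, h.2]

theorem Complex.arg_sub_arg_mem_of_im_pos {z w : ℂ} (hz : 0 < z.im) (hw : 0 < w.im) :
    z.arg - w.arg ∈ Set.Ioc (-π) π := by
  have h1 := Complex.arg_nonneg_iff.2 hz.le
  have h2 := Complex.arg_nonneg_iff.2 hw.le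
  have h3 := Complex.arg_le_pi z
  have h4 : w.arg < π := Complex.arg_lt_pi_iff.2 (Or.inr hw.ne')
  constructor <;> linarith

theorem Complex.arg_sub_arg_mem_of_im_neg {z w : ℂ} (hz : z.im < 0) (hw : w.im < 0) :
    z.arg - w.arg ∈ Set.Ioc (-π) π := by
  have h1 := Complex.arg_neg_iff.2 hz
  have h2 := Complex.arg_neg_iff.2 hw
  have h3 := Complex.neg_pi_lt_arg z
  have h4 := Complex.neg_pi_lt_arg w
  constructor <;> linarith

/-- Two points strictly on the same side of the real axis have arguments differing by less than π,
and a common change of sign preserves this. The unit `u` selects the branch used for poles on the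
left (1) or on the right (-1). -/
theorem Complex.log_div_eq_of_unit {z w u : ℂ} (hu : u = 1 ∨ u = -1)
    (h : 0 < z.im ∧ 0 < w.im ∨ z.im < 0 ∧ w.im < 0) :
    Complex.log (z / w) = Complex.log (u * z) - Complex.log (u * w) := by
  have ne : ∀ x : ℂ, (x.im ≠ 0) → x ≠ 0 := fun x hx h0 => hx (by simp [h0])
  rcases hu with rfl | rfl
  · simp only [one_mul]
    rcases h with ⟨h1, h2⟩ | ⟨h1, h2⟩
    · exact log_sub_log_eq_log_div (ne _ h1.ne') (ne _ h2.ne') (arg_sub_arg_mem_of_im_pos h1 h2)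
    · exact log_sub_log_eq_log_div (ne _ h1.ne) (ne _ h2.ne) (arg_sub_arg_mem_of_im_neg h1 h2)
  · simp only [neg_mul, one_mul]
    rw [← neg_div_neg_eq]
    rcases h with ⟨h1, h2⟩ | ⟨h1, h2⟩
    · exact log_sub_log_eq_log_div (neg_ne_zero.2 (ne _ h1.ne')) (neg_ne_zero.2 (ne _ h2.ne'))
        (arg_sub_arg_mem_of_im_neg (by simpa using h1) (by simpa using h2))
    · exact log_sub_log_eq_log_div (neg_ne_zero.2 (ne _ h1.ne)) (neg_ne_zero.2 (ne _ h2.ne))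
        (arg_sub_arg_mem_of_im_pos (by simpa using h1) (by simpa using h2))

/-- Two points closer to each other than to the path have `∫ dz / (z - p)` differing by the
logarithms of the quotients at the ends. -/
theorem IsPiecewiseC1.integral_inv_sub_sub_integral_inv_sub {γ : ℝ → ℂ} (h : IsPiecewiseC1 γ)
    {p q : ℂ} {a b : ℝ} (hpq : ∀ t ∈ Set.uIcc a b, ‖p - q‖ < ‖γ t - q‖) :
    (∫ t in a..b, (γ t - p)⁻¹ * deriv γ t) - (∫ t in a..b, (γ t - q)⁻¹ * deriv γ t) =
      Complex.log ((γ b - p) / (γ b - q)) - Complex.log ((γ a - p) / (γ a - q)) := by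
  have hq : ∀ t ∈ Set.uIcc a b, γ t - q ≠ 0 := fun t ht h0 => by
    have := hpq t ht
    rw [h0, norm_zero] at this
    exact absurd this (norm_nonneg _).not_gt
  have hp : ∀ t ∈ Set.uIcc a b, γ t - p ≠ 0 := fun t ht h0 => by
    have := hpq t ht
    rw [sub_eq_zero.1 h0] at this
    exact lt_irrefl _ this
  -- The quotient stays in the unit disc about 1, so its principal logarithm is a primitive of the
  -- difference of the two integrands.
  have hsl : ∀ t ∈ Set.uIcc a b, (γ t - p) / (γ t - q) ∈ Complex.slitPlane := fun t ht => by
    have e : (γ t - p) / (γ t - q) = 1 + (q - p) / (γ t - q) := by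
      field_simp [hq t ht]; ring
    rw [e]
    apply Complex.mem_slitPlane_of_norm_lt_one
    rw [norm_div, norm_sub_rev, div_lt_one (norm_pos_iff.2 (hq t ht))]
    exact hpq t ht
  have cp := (h.1.continuousOn.sub continuousOn_const).inv₀ hp
  have cq := (h.1.continuousOn.sub continuousOn_const).inv₀ hq
  rw [← intervalIntegral.integral_sub (h.intervalIntegrable_comp_mul_deriv (f := fun z => (z - p)⁻¹) cp)
    (h.intervalIntegrable_comp_mul_deriv (f := fun z => (z - q)⁻¹) cq)]
  simp_rw [← sub_mul]
  refine h.integral_comp_mul_deriv (F := fun z => Complex.log ((z - p) / (z - q)))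
    (f := fun z => (z - p)⁻¹ - (z - q)⁻¹) (fun t ht => ?_) (cp.sub cq)
  have := (((hasDerivAt_id (γ t)).sub_const p).div ((hasDerivAt_id (γ t)).sub_const q)
    (hq t ht)).clog (hsl t ht)
  convert! this using 1
  have h1 := hp t ht
  have h2 := hq t ht
  simp
  field_simp
  ring

/-- Deformation of the pole: the defect between the two sides is locally constant along `σ`, and it
vanishes at `q`, where the logarithm is a primitive along the whole arc. Since `σ` stays strictly
between the heights of the ends of the arc, the end logarithms never cross their cut. -/
theorem IsPiecewiseC1.integral_inv_sub_of_path {γ : ℝ → ℂ} (h : IsPiecewiseC1 γ) {u : ℂ}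
    (hu : u = 1 ∨ u = -1) {a b : ℝ} {p q : ℂ} (σ : Path p q) (hσ : ∀ τ, σ τ ∉ Set.range γ)
    (hb : ∀ τ, (σ τ).im < (γ b).im) (ha : ∀ τ, (γ a).im < (σ τ).im)
    (hq : ∀ t ∈ Set.uIcc a b, u * (γ t - q) ∈ Complex.slitPlane) :
    ∫ t in a..b, (γ t - p)⁻¹ * deriv γ t =
      Complex.log (u * (γ b - p)) - Complex.log (u * (γ a - p)) := by
  let φ : unitInterval → ℂ := fun τ => (∫ t in a..b, (γ t - σ τ)⁻¹ * deriv γ t) -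
      (Complex.log (u * (γ b - σ τ)) - Complex.log (u * (γ a - σ τ)))
  have hφ : IsLocallyConstant φ := by
    rw [IsLocallyConstant.iff_eventually_eq]
    intro τ₀
    -- The distance from `σ τ₀` to the arc is attained at `t₀` and is positive; poles within that
    -- distance of `σ τ₀` can be compared with it.
    obtain ⟨t₀, -, hm⟩ := isCompact_uIcc.exists_isMinOn Set.nonempty_uIcc
      ((h.1.continuousOn (s := Set.uIcc a b)).sub (continuousOn_const (c := σ τ₀))).norm
    have hpos : 0 < ‖γ t₀ - σ τ₀‖ :=
      norm_pos_iff.2 (sub_ne_zero.2 fun h0 => hσ τ₀ ⟨t₀, h0⟩)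
    have hev : ∀ᶠ τ in 𝓝 τ₀, ‖σ τ - σ τ₀‖ < ‖γ t₀ - σ τ₀‖ := by
      have : Tendsto (fun τ => ‖σ τ - σ τ₀‖) (𝓝 τ₀) (𝓝 ‖σ τ₀ - σ τ₀‖) :=
        ((σ.continuous.sub continuous_const).norm).tendsto τ₀
      rw [sub_self, norm_zero] at this
      exact this.eventually_lt_const hpos
    filter_upwards [hev] with τ hτ
    have e := h.integral_inv_sub_sub_integral_inv_sub (p := σ τ) (q := σ τ₀) (a := a) (b := b)
      fun t ht => hτ.trans_le (hm ht)
    rw [Complex.log_div_eq_of_unit hu (Or.inl ⟨by simpa using hb τ, by simpa using hb τ₀⟩),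
      Complex.log_div_eq_of_unit hu (Or.inr ⟨by simpa using ha τ, by simpa using ha τ₀⟩)] at e
    simp only [φ]
    linear_combination e
  have h01 : φ 0 = φ 1 := hφ.apply_eq_of_preconnectedSpace 0 1
  have hu0 : u ≠ 0 := by rcases hu with rfl | rfl <;> simp
  have h1 : φ 1 = 0 := by
    simp only [φ, σ.target]
    rw [h.integral_inv_sub_of_slitPlane hu0 hq, sub_self]
  rw [h1] at h01
  simp only [φ, σ.source] at h01
  exact sub_eq_zero.1 h01

theorem IsPiecewiseC1.eventually_integral_inv_sub_of_joinedIn {γ : ℝ → ℂ} (h : IsPiecewiseC1 γ)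
    (hbot : Tendsto (fun t => (γ t).im) atBot atBot) (htop : Tendsto (fun t => (γ t).im) atTop atTop)
    {u : ℂ} (hu : u = 1 ∨ u = -1) {p q : ℂ} (hpq : JoinedIn (Set.range γ)ᶜ p q)
    (hq : ∀ t, u * (γ t - q) ∈ Complex.slitPlane) :
    ∀ᶠ ab : ℝ × ℝ in atBot ×ˢ atTop, ∫ t in ab.1..ab.2, (γ t - p)⁻¹ * deriv γ t =
      Complex.log (u * (γ ab.2 - p)) - Complex.log (u * (γ ab.1 - p)) := by
  obtain ⟨σ, hσ⟩ := hpq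
  obtain ⟨A, hA⟩ := (isCompact_range (Complex.continuous_im.comp σ.continuous)).bddAbove
  obtain ⟨B, hB⟩ := (isCompact_range (Complex.continuous_im.comp σ.continuous)).bddBelow
  filter_upwards [(hbot.eventually_lt_atBot B).prod_mk (htop.eventually_gt_atTop A)] with ab hab
  exact h.integral_inv_sub_of_path hu σ hσ (fun τ => (hA ⟨τ, rfl⟩).trans_lt hab.2)
    (fun τ => hab.1.trans_le (hB ⟨τ, rfl⟩)) fun t _ => hq t

/-- Choose the target of the deformation at a real `x` beyond the bound for |Re γ|: then `-(γ t -
x)` has positive real part for all `t`. The left-hand case is the mirror image, with sign 1. -/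
theorem IsBarnesPath.eventually_integral_inv_sub_of_right {γ : ℝ → ℂ} (h : IsBarnesPath γ) {p : ℂ}
    (hp : LiesRightOf p γ) :
    ∀ᶠ ab : ℝ × ℝ in atBot ×ˢ atTop, ∫ t in ab.1..ab.2, (γ t - p)⁻¹ * deriv γ t =
      Complex.log (-(γ ab.2 - p)) - Complex.log (-(γ ab.1 - p)) := by
  obtain ⟨M, hM⟩ := h.bounded_re
  obtain ⟨x, hx, hxM⟩ := (hp.and (eventually_gt_atTop M)).exists
  have := h.piecewiseC1.eventually_integral_inv_sub_of_joinedIn h.tendsto_bot h.tendsto_top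
    (u := -1) (Or.inr rfl) hx fun t => by
      left
      have := (abs_le.1 (hM t)).2
      simp
      linarith
  simpa only [neg_mul, one_mul] using this

theorem IsBarnesPath.eventually_integral_inv_sub_of_left {γ : ℝ → ℂ} (h : IsBarnesPath γ) {p : ℂ}
    (hp : LiesLeftOf p γ) :
    ∀ᶠ ab : ℝ × ℝ in atBot ×ˢ atTop, ∫ t in ab.1..ab.2, (γ t - p)⁻¹ * deriv γ t =
      Complex.log (γ ab.2 - p) - Complex.log (γ ab.1 - p) := by
  obtain ⟨M, hM⟩ := h.bounded_re
  obtain ⟨x, hx, hxM⟩ := (hp.and (eventually_lt_atBot (-M))).exists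
  have := h.piecewiseC1.eventually_integral_inv_sub_of_joinedIn h.tendsto_bot h.tendsto_top
    (u := 1) (Or.inl rfl) hx fun t => by
      left
      have := (abs_le.1 (hM t)).1
      simp
      linarith
  simpa only [one_mul] using this

/-! ### Principal parts and a primitive on a strip -/

/-- Subtracting the principal parts at finitely many simple poles. -/
theorem exists_differentiableOn_eq_sub_sum_div {f : ℂ → ℂ} (ρ : ℤ → ℂ) (S : Finset ℤ) :
    ∀ {U : Set ℂ}, IsOpen U → (∀ n ∈ S, (n : ℂ) ∈ U) →
    (∀ s ∈ U, (∀ n ∈ S, s ≠ n) → DifferentiableAt ℂ f s) →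
    (∀ n ∈ S, Tendsto (fun s => (s - n) * f s) (𝓝[≠] (n : ℂ)) (𝓝 (ρ n))) →
    ∃ f₀ : ℂ → ℂ, DifferentiableOn ℂ f₀ U ∧
      ∀ s ∈ U, (∀ n ∈ S, s ≠ n) → f₀ s = f s - ∑ n ∈ S, ρ n / (s - n) := by
  induction S using Finset.induction_on with
  | empty =>
    intro U hU _ hf _
    exact ⟨f, fun s hs => (hf s hs (by simp)).differentiableWithinAt, fun s _ _ => by simp⟩
  | insert n S hn ih =>
    intro U hU hSU hf hres
    obtain ⟨f₁, hd, he⟩ := ih (U := U \ {(n : ℂ)}) (hU.sdiff isClosed_singleton)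
      (fun m hm => ⟨hSU m (Finset.mem_insert_of_mem hm), fun h0 => by
        have : m = n := by exact_mod_cast (show (m : ℂ) = n from h0)
        exact hn (this ▸ hm)⟩)
      (fun s hs hm => hf s hs.1 fun m hm' => by
        rcases Finset.mem_insert.1 hm' with rfl | h1
        · exact hs.2
        · exact hm m h1)
      (fun m hm => hres m (Finset.mem_insert_of_mem hm))
    have hnU : U ∈ 𝓝 (n : ℂ) := hU.mem_nhds (hSU n (Finset.mem_insert_self _ _))
    set k : ℂ → ℂ := fun s => f₁ s - ρ n / (s - n) with hk
    have hkd : DifferentiableOn ℂ k (U \ {(n : ℂ)}) := by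
      refine hd.sub ((differentiableOn_const _).div (differentiableOn_id.sub_const _) ?_)
      exact fun s hs => sub_ne_zero.2 hs.2
    have hkf : ∀ s ∈ U, (∀ m ∈ insert n S, s ≠ m) →
        k s = f s - ∑ m ∈ insert n S, ρ m / (s - m) := by
      intro s hs hm
      rw [Finset.sum_insert hn, hk]
      simp only
      rw [he s ⟨hs, hm n (Finset.mem_insert_self _ _)⟩
        fun m h1 => hm m (Finset.mem_insert_of_mem h1)]
      ring
    -- Riemann's removability criterion at `n`. The value `k n` comes from a division by zero, but
    -- it is harmless: it is multiplied by `s - n`, which tends to 0.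
    have hlim : Tendsto (fun s => (k s - k n) * (s - n)) (𝓝[≠] (n : ℂ)) (𝓝 0) := by
      have hS : ∀ᶠ s : ℂ in 𝓝 (n : ℂ), ∀ m ∈ S, s ≠ m := by
        rw [Filter.eventually_all_finset]
        intro m hm
        refine isOpen_ne.mem_nhds fun h0 => hn ?_
        have : n = m := by exact_mod_cast h0
        exact this ▸ hm
      have h0 : Tendsto (fun s : ℂ => s - n) (𝓝[≠] (n : ℂ)) (𝓝 0) := by
        have : Tendsto (fun s : ℂ => s - n) (𝓝 (n : ℂ)) (𝓝 (n - n)) :=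
          (continuous_id.sub continuous_const).tendsto _
        rw [sub_self] at this
        exact this.mono_left nhdsWithin_le_nhds
      have hsum : Tendsto (fun s : ℂ => ∑ m ∈ S, ρ m / (s - m)) (𝓝[≠] (n : ℂ))
          (𝓝 (∑ m ∈ S, ρ m / ((n : ℂ) - m))) := by
        refine tendsto_finsetSum _ fun m hm => ?_
        have : ContinuousAt (fun s : ℂ => ρ m / (s - m)) n := by
          refine continuousAt_const.div (continuousAt_id.sub continuousAt_const) ?_
          refine sub_ne_zero.2 fun h0 => hn ?_
          have : n = m := by exact_mod_cast h0
          exact this ▸ hm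
        exact this.tendsto.mono_left nhdsWithin_le_nhds
      have h1 := ((hres n (Finset.mem_insert_self _ _)).sub (h0.mul hsum)).sub_const (ρ n)
      have h2 := h1.sub (h0.const_mul (k n))
      simp only [zero_mul, sub_zero, sub_self, mul_zero] at h2
      refine h2.congr' ?_
      filter_upwards [self_mem_nhdsWithin, nhdsWithin_le_nhds hS, nhdsWithin_le_nhds hnU]
        with s hs hsS hsU
      have hs' : s - n ≠ 0 := sub_ne_zero.2 hs
      rw [hkf s hsU (Finset.forall_mem_insert _ _ _ |>.2 ⟨hs, hsS⟩), Finset.sum_insert hn]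
      field_simp
      ring
    refine ⟨_, Complex.differentiableOn_update_limUnder_of_isLittleO hnU hkd ?_, fun s hs hm => ?_⟩
    · refine Asymptotics.isLittleO_of_tendsto' ?_ ?_
      · filter_upwards [self_mem_nhdsWithin] with s hs h0
        exact absurd (sub_eq_zero.1 (inv_eq_zero.1 h0)) hs
      · simpa only [div_inv_eq_mul] using hlim
    · rw [Function.update_of_ne (hm n (Finset.mem_insert_self _ _))]
      exact hkf s hs hm

/-- This is the residue: sin(πs) vanishes at `n` with derivative (-1)^n π, so its inverted
difference quotients converge. -/
theorem Complex.tendsto_sub_mul_pi_div_sin {g : ℂ → ℂ} (hg : Continuous g) (n : ℤ) :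
    Tendsto (fun s : ℂ => (s - n) * (g s * (π / Complex.sin (π * s)))) (𝓝[≠] (n : ℂ))
      (𝓝 ((-1) ^ n * g n)) := by
  have hsin : Complex.sin (π * n) = 0 := Complex.sin_eq_zero_iff.2 ⟨n, mul_comm _ _⟩
  have hcos : Complex.cos (π * n) = (-1) ^ n := by
    rw [mul_comm]
    have := congrArg (fun x : ℝ => (x : ℂ)) (Real.cos_int_mul_pi n)
    push_cast at this
    exact this
  have hd : HasDerivAt (fun s : ℂ => Complex.sin (π * s)) ((-1) ^ n * π) n := by
    have := ((hasDerivAt_id (n : ℂ)).const_mul (π : ℂ)).csin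
    simp only [id, hcos, mul_one] at this
    exact this
  have hne : ((-1) ^ n * π : ℂ) ≠ 0 :=
    mul_ne_zero (zpow_ne_zero _ (by norm_num)) (by exact_mod_cast Real.pi_ne_zero)
  have h1 := (hasDerivAt_iff_tendsto_slope.1 hd).inv₀ hne
  have h2 := (h1.mul_const (π : ℂ)).mul ((hg.tendsto n).mono_left (nhdsWithin_le_nhds (s := {(n : ℂ)}ᶜ)))
  have e : ((-1) ^ n * π : ℂ)⁻¹ * π * g n = (-1) ^ n * g n := by
    have : (π : ℂ) ≠ 0 := by exact_mod_cast Real.pi_ne_zero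
    rw [mul_inv, inv_mul_cancel_right₀ this, ← inv_zpow]
    norm_num
  rw [e] at h2
  refine h2.congr fun s => ?_
  rw [slope_def_field, hsin, sub_zero, inv_div]
  ring

theorem Complex.sin_pi_mul_ne_zero {s : ℂ} (hs : ∀ n : ℤ, s ≠ n) : Complex.sin (π * s) ≠ 0 := by
  rw [Ne, Complex.sin_eq_zero_iff]
  rintro ⟨k, hk⟩
  have : (π : ℂ) ≠ 0 := by exact_mod_cast Real.pi_ne_zero
  exact hs k (mul_left_cancel₀ this (by rw [hk, mul_comm]))

/-- A primitive, on a vertical strip, of `g π / sin (π s)` minus its principal parts. -/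
theorem exists_hasDerivAt_mul_pi_div_sin_sub_sum {g : ℂ → ℂ} (hg : Differentiable ℂ g) (N : ℕ) :
    ∃ F : ℂ → ℂ, ∀ s : ℂ, |s.re| < N + 1 → (∀ n : ℤ, s ≠ n) →
      HasDerivAt F (g s * (π / Complex.sin (π * s)) -
        ∑ n ∈ Finset.Icc (-N : ℤ) N, ((-1) ^ n * g n) / (s - n)) s := by
  set U : Set ℂ := Complex.re ⁻¹' Set.Ioo (-(N + 1 : ℝ)) (N + 1) with hUdef
  have hU : IsOpen U := isOpen_Ioo.preimage Complex.continuous_re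
  have hUc : Convex ℝ U := (convex_Ioo _ _).linear_preimage Complex.reLm
  -- The open strip contains no integers other than those from -N to N.
  have hint : ∀ s ∈ U, (∀ n ∈ Finset.Icc (-N : ℤ) N, s ≠ n) → ∀ n : ℤ, s ≠ n := by
    rintro s ⟨h1, h2⟩ hs n rfl
    rw [Complex.intCast_re] at h1 h2
    refine hs n (Finset.mem_Icc.2 ⟨?_, ?_⟩) rfl
    · have : (-(N + 1 : ℤ)) < n := by exact_mod_cast h1
      omega
    · have : n < (N + 1 : ℤ) := by exact_mod_cast h2
      omega
  obtain ⟨f₀, hd, he⟩ := exists_differentiableOn_eq_sub_sum_div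
    (f := fun s => g s * (π / Complex.sin (π * s))) (fun n => (-1) ^ n * g n)
    (Finset.Icc (-N : ℤ) N) hU
    (fun n hn => by
      rw [Finset.mem_Icc] at hn
      change (n : ℂ).re ∈ Set.Ioo (-(N + 1 : ℝ)) (N + 1)
      rw [Complex.intCast_re]
      constructor
      · have : (-(N + 1 : ℤ)) < n := by omega
        exact_mod_cast this
      · have : n < (N + 1 : ℤ) := by omega
        exact_mod_cast this)
    (fun s hs hn => (hg s).mul ((differentiableAt_const _).div
      ((differentiableAt_id.const_mul _).csin) (Complex.sin_pi_mul_ne_zero (hint s hs hn))))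
    (fun n _ => Complex.tendsto_sub_mul_pi_div_sin hg.continuous n)
  obtain ⟨F, hF⟩ := hUc.exists_forall_hasDerivWithinAt hd
  refine ⟨F, fun s hs hn => ?_⟩
  have hsU : s ∈ U := abs_lt.1 hs
  rw [← he s hsU fun n _ => hn n]
  exact (hF s hsU).hasDerivAt (hU.mem_nhds hsU)

theorem Complex.log_neg_of_im_pos {z : ℂ} (hz : 0 < z.im) :
    Complex.log (-z) = Complex.log z - π * Complex.I := by
  simp only [Complex.log, norm_neg, Complex.arg_neg_eq_arg_sub_pi_of_im_pos hz]
  push_cast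
  ring

theorem Complex.log_neg_of_im_neg {z : ℂ} (hz : z.im < 0) :
    Complex.log (-z) = Complex.log z + π * Complex.I := by
  simp only [Complex.log, norm_neg, Complex.arg_neg_eq_arg_add_pi_of_im_neg hz]
  push_cast
  ring

theorem sum_Icc_neg_ite_nonneg (N : ℕ) (a : ℤ → ℂ) :
    (∑ n ∈ Finset.Icc (-N : ℤ) N, if 0 ≤ n then a n else 0) = ∑ n ∈ Finset.range (N + 1), a n := by
  rw [← Finset.sum_filter]
  symm
  refine Finset.sum_bij (fun n _ => (n : ℤ)) ?_ ?_ ?_ ?_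
  · intro n hn
    have := Finset.mem_range.1 hn
    simp only [Finset.mem_filter, Finset.mem_Icc]
    omega
  · intro a _ b _ h
    exact_mod_cast h
  · intro n hn
    simp only [Finset.mem_filter, Finset.mem_Icc] at hn
    exact ⟨n.toNat, Finset.mem_range.2 (by omega), by omega⟩
  · intro n _
    rfl

theorem JoinedIn.ne_of_compl_range {γ : ℝ → ℂ} {p q : ℂ} (h : JoinedIn (Set.range γ)ᶜ p q) (t : ℝ) :
    γ t ≠ p := fun h0 => h.source_mem ⟨t, h0⟩

theorem IsBarnesPath.ne_intCast {γ : ℝ → ℂ} (h : IsBarnesPath γ) (t : ℝ) (n : ℤ) : γ t ≠ n := by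
  rcases le_or_gt 0 n with hn | hn
  · obtain ⟨m, rfl⟩ := Int.eq_ofNat_of_zero_le hn
    obtain ⟨x, hx⟩ := (h.right_poles m).exists
    exact_mod_cast hx.ne_of_compl_range t
  · obtain ⟨m, rfl⟩ : ∃ m : ℕ, n = -(m : ℤ) := ⟨n.natAbs, by omega⟩
    obtain ⟨x, hx⟩ := (h.left_poles m (by omega)).exists
    simpa using hx.ne_of_compl_range t

/-- For all sufficiently distant endpoints, `∫ dz / (z - n)` over a Barnes path is the difference
of the values of `log (z - n)` at the ends, corrected by `- 2 π i` if `n` is on the right. -/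
theorem IsBarnesPath.eventually_integral_inv_sub_intCast {γ : ℝ → ℂ} (h : IsBarnesPath γ) (n : ℤ) :
    ∀ᶠ ab : ℝ × ℝ in atBot ×ˢ atTop, ∫ t in ab.1..ab.2, (γ t - n)⁻¹ * deriv γ t =
      Complex.log (γ ab.2 - n) - Complex.log (γ ab.1 - n) -
        if 0 ≤ n then 2 * π * Complex.I else 0 := by
  rcases le_or_gt 0 n with hn | hn
  · have hr : LiesRightOf (n : ℂ) γ := by
      obtain ⟨m, rfl⟩ := Int.eq_ofNat_of_zero_le hn
      exact_mod_cast h.right_poles m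
    -- With the ends above and below the real axis, replacing log(-w) by log w costs -πi at the top
    -- and +πi at the bottom, hence -2πi in the difference.
    filter_upwards [h.eventually_integral_inv_sub_of_right hr,
      (h.tendsto_bot.eventually_lt_atBot 0).prod_mk (h.tendsto_top.eventually_gt_atTop 0)]
      with ab hab him
    rw [hab, Complex.log_neg_of_im_pos (by simpa using him.2),
      Complex.log_neg_of_im_neg (by simpa using him.1), if_pos hn]
    ring
  · have hl : LiesLeftOf (n : ℂ) γ := by
      obtain ⟨m, rfl⟩ : ∃ m : ℕ, n = -(m : ℤ) := ⟨n.natAbs, by omega⟩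
      have := h.left_poles m (by omega)
      exact_mod_cast this
    filter_upwards [h.eventually_integral_inv_sub_of_left hl] with ab hab
    rw [hab, if_neg hn.not_ge, sub_zero]

/-- Take `H` as the primitive of the regular part plus the sum of residues times log(s-n). It is a
true primitive off the real axis and on Re s = N+1/2, which lies to the right of every branch point.
A path may cross the cuts; the resulting corrections come exactly from the poles n ≥ 0. -/
theorem exists_primitive_and_eventually_integral_eq {g : ℂ → ℂ} (hg : Differentiable ℂ g) (N : ℕ) :
    ∃ H : ℂ → ℂ,
      (∀ s : ℂ, |s.re| < N + 1 → (s.im ≠ 0 ∨ s.re = N + 1 / 2) →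
        HasDerivAt H (g s * (π / Complex.sin (π * s))) s) ∧
      ∀ γ : ℝ → ℂ, IsBarnesPath γ → (∀ t, |(γ t).re| < N + 1) →
        ∀ᶠ ab : ℝ × ℝ in atBot ×ˢ atTop,
          ∫ t in ab.1..ab.2, g (γ t) * (π / Complex.sin (π * γ t)) * deriv γ t =
            H (γ ab.2) - H (γ ab.1) -
              2 * π * Complex.I * ∑ n ∈ Finset.range (N + 1), (-1) ^ n * g n := by
  obtain ⟨F, hF⟩ := exists_hasDerivAt_mul_pi_div_sin_sub_sum hg N
  set S := Finset.Icc (-N : ℤ) N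
  set ρ : ℤ → ℂ := fun n => (-1) ^ n * g n with hρ
  refine ⟨fun s => F s + ∑ n ∈ S, ρ n * Complex.log (s - n), ?_, ?_⟩
  · intro s hs hs'
    have hint : ∀ n : ℤ, s ≠ n := by
      rintro n rfl
      rcases hs' with h | h
      · simp at h
      · rw [Complex.intCast_re] at h
        have : (2 * n : ℝ) = 2 * N + 1 := by linarith
        have : 2 * n = 2 * (N : ℤ) + 1 := by exact_mod_cast this
        omega
    have hlog : ∀ n ∈ S, HasDerivAt (fun s => ρ n * Complex.log (s - n)) (ρ n / (s - n)) s := by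
      intro n hn
      have hsl : s - n ∈ Complex.slitPlane := by
        rcases hs' with h | h
        · right; simpa using h
        · left
          have : n ≤ (N : ℤ) := (Finset.mem_Icc.1 hn).2
          have : (n : ℝ) ≤ N := by exact_mod_cast this
          simp only [Complex.sub_re, Complex.intCast_re, h]
          linarith
      have := (((hasDerivAt_id s).sub_const (n : ℂ)).clog hsl).const_mul (ρ n)
      simpa [mul_div_assoc', div_eq_mul_inv] using this
    have := (hF s hs hint).add (HasDerivAt.fun_sum hlog)
    convert! this using 1
    simp [hρ]
  · intro γ hγ hN
    have hall : ∀ᶠ ab : ℝ × ℝ in atBot ×ˢ atTop, ∀ n ∈ S,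
        ∫ t in ab.1..ab.2, (γ t - n)⁻¹ * deriv γ t =
          Complex.log (γ ab.2 - n) - Complex.log (γ ab.1 - n) -
            if 0 ≤ n then 2 * π * Complex.I else 0 := by
      rw [Filter.eventually_all_finset]
      exact fun n _ => hγ.eventually_integral_inv_sub_intCast n
    filter_upwards [hall] with ab hab
    have hc := hγ.piecewiseC1.1
    have hcf : Continuous fun t => g (γ t) * (π / Complex.sin (π * γ t)) :=
      (hg.continuous.comp hc).mul (continuous_const.div
        (Complex.continuous_sin.comp (continuous_const.mul hc))
        fun t => Complex.sin_pi_mul_ne_zero (hγ.ne_intCast t))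
    have hcn : ∀ n : ℤ, Continuous fun t => (γ t - n)⁻¹ := fun n =>
      (hc.sub continuous_const).inv₀ fun t => sub_ne_zero.2 (hγ.ne_intCast t n)
    have hcs : Continuous fun t => ∑ n ∈ S, ρ n / (γ t - n) :=
      continuous_finsetSum _ fun n _ => by
        simp only [div_eq_mul_inv]
        exact continuous_const.mul (hcn n)
    have i₀ := hγ.piecewiseC1.integral_comp_mul_deriv (F := F)
      (f := fun s => g s * (π / Complex.sin (π * s)) - ∑ n ∈ S, ρ n / (s - n)) (a := ab.1) (b := ab.2)
      (fun t _ => hF (γ t) (hN t) (hγ.ne_intCast t)) (hcf.sub hcs).continuousOn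
    have i₁ : ∫ t in ab.1..ab.2, ∑ n ∈ S, ρ n * ((γ t - n)⁻¹ * deriv γ t) =
        ∑ n ∈ S, ρ n * ((Complex.log (γ ab.2 - n) - Complex.log (γ ab.1 - n)) -
          if 0 ≤ n then 2 * π * Complex.I else 0) := by
      rw [intervalIntegral.integral_finsetSum]
      · refine Finset.sum_congr rfl fun n hn => ?_
        rw [intervalIntegral.integral_const_mul, hab n hn]
      · exact fun n _ => (hγ.piecewiseC1.intervalIntegrable_comp_mul_deriv
          (f := fun z => (z - n)⁻¹) (hcn n).continuousOn).const_mul _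
    have i₂ : ∫ t in ab.1..ab.2, g (γ t) * (π / Complex.sin (π * γ t)) * deriv γ t =
        (∫ t in ab.1..ab.2, (g (γ t) * (π / Complex.sin (π * γ t)) -
            ∑ n ∈ S, ρ n / (γ t - n)) * deriv γ t) +
          ∫ t in ab.1..ab.2, ∑ n ∈ S, ρ n * ((γ t - n)⁻¹ * deriv γ t) := by
      rw [← intervalIntegral.integral_add]
      · refine intervalIntegral.integral_congr fun t _ => ?_
        simp only [div_eq_mul_inv, ← mul_assoc, ← Finset.sum_mul]
        ring
      · exact hγ.piecewiseC1.intervalIntegrable_comp_mul_deriv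
          (f := fun s => g s * (π / Complex.sin (π * s)) - ∑ n ∈ S, ρ n / (s - n))
          (hcf.sub hcs).continuousOn
      · have := hγ.piecewiseC1.intervalIntegrable_comp_mul_deriv
          (f := fun s => ∑ n ∈ S, ρ n / (s - n)) (a := ab.1) (b := ab.2) hcs.continuousOn
        simpa only [div_eq_mul_inv, Finset.sum_mul, mul_assoc] using this
    have i₃ := sum_Icc_neg_ite_nonneg N fun n => ρ n
    rw [i₂, i₀, i₁]
    have i₄ : ∑ n ∈ S, ρ n * (if 0 ≤ n then 2 * π * Complex.I else 0) =
        2 * π * Complex.I * ∑ n ∈ Finset.range (N + 1), (-1) ^ n * g n := by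
      have : ∑ n ∈ Finset.range (N + 1), (-1) ^ n * g n = ∑ n ∈ Finset.range (N + 1), ρ n := by
        simp [hρ]
      rw [this, ← i₃, Finset.mul_sum]
      refine Finset.sum_congr rfl fun n _ => ?_
      split_ifs <;> ring
    simp only [mul_sub, Finset.sum_sub_distrib, i₄]
    ring

/-! ### Bounds for the sine and evaluation by residues -/

/-- From 2|sin z| ≥ e^{|Im z|} - e^{-|Im z|}: for |Im s| ≥ 1 the subtracted term is at most 1 and
the main one at least 2. -/
theorem Complex.norm_sin_ge_of_one_le_abs_im {s : ℂ} (hs : 1 ≤ |s.im|) :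
    Real.exp (π * |s.im|) / 4 ≤ ‖Complex.sin (π * s)‖ := by
  have key : ∀ z : ℂ, Real.exp |z.im| - Real.exp (-|z.im|) ≤ 2 * ‖Complex.sin z‖ := by
    intro z
    have e : 2 * ‖Complex.sin z‖ = ‖Complex.exp (-z * Complex.I) - Complex.exp (z * Complex.I)‖ := by
      rw [Complex.sin, norm_div, norm_mul, Complex.norm_I, mul_one, Complex.norm_ofNat]
      ring
    have n1 : ‖Complex.exp (-z * Complex.I)‖ = Real.exp z.im := by simp [Complex.norm_exp]
    have n2 : ‖Complex.exp (z * Complex.I)‖ = Real.exp (-z.im) := by simp [Complex.norm_exp]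
    rw [e]
    have h := abs_norm_sub_norm_le (Complex.exp (-z * Complex.I)) (Complex.exp (z * Complex.I))
    rw [n1, n2] at h
    refine le_trans ?_ h
    rcases abs_cases z.im with ⟨h1, _⟩ | ⟨h1, _⟩ <;> rw [h1]
    · exact le_abs_self _
    · rw [neg_neg]
      exact (le_abs_self _).trans (abs_sub_comm _ _).le
  have h := key (π * s)
  rw [Complex.im_ofReal_mul, abs_mul, abs_of_pos Real.pi_pos] at h
  have h1 : Real.exp (-(π * |s.im|)) ≤ 1 := by
    rw [Real.exp_le_one_iff]
    have := Real.pi_pos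
    nlinarith
  have h2 : 2 ≤ Real.exp (π * |s.im|) := by
    have := Real.add_one_le_exp (π * |s.im|)
    have := Real.pi_gt_three
    nlinarith
  linarith

/-- On this line |sin(πs)| = cosh(π Im s), so no lower bound on |Im s| is required. -/
theorem Complex.norm_sin_ge_of_re_eq_half {s : ℂ} {N : ℕ} (hs : s.re = N + 1 / 2) :
    Real.exp (π * |s.im|) / 4 ≤ ‖Complex.sin (π * s)‖ := by
  have e : (π : ℂ) * s = ((π * s.im : ℝ) * Complex.I + N * π) + π / 2 := by
    conv_lhs => rw [← Complex.re_add_im s, hs]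
    push_cast
    ring
  have hcos : ∀ z : ℂ, Complex.cos (z + N * π) = (-1) ^ N * Complex.cos z := fun z => by
    simpa using Complex.cos_antiperiodic.add_nat_mul_eq (x := z) N
  rw [e, Complex.sin_add_pi_div_two, hcos, norm_mul, norm_pow, norm_neg,
    norm_one, one_pow, one_mul, Complex.cos_mul_I, ← Complex.ofReal_cosh, Complex.norm_real,
    Real.norm_of_nonneg (Real.cosh_pos _).le, ← Real.cosh_abs, abs_mul, abs_of_pos Real.pi_pos,
    Real.cosh_eq]
  have := Real.exp_pos (π * |s.im|)
  have := Real.exp_pos (-(π * |s.im|))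
  linarith

theorem norm_mul_pi_div_sin_le {g : ℂ → ℂ} {s : ℂ} {K δ : ℝ} {N : ℕ}
    (hs : 1 ≤ |s.im| ∨ s.re = N + 1 / 2) (hg : ‖g s‖ ≤ K * Real.exp ((π - δ) * |s.im|)) :
    ‖g s * (π / Complex.sin (π * s))‖ ≤ 4 * π * K * Real.exp (-δ * |s.im|) := by
  have hsin : Real.exp (π * |s.im|) / 4 ≤ ‖Complex.sin (π * s)‖ :=
    hs.elim Complex.norm_sin_ge_of_one_le_abs_im Complex.norm_sin_ge_of_re_eq_half
  have hpos : 0 < Real.exp (π * |s.im|) / 4 := by positivity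
  rw [norm_mul, norm_div, Complex.norm_real, Real.norm_of_nonneg Real.pi_pos.le]
  calc ‖g s‖ * (π / ‖Complex.sin (π * s)‖)
      ≤ (K * Real.exp ((π - δ) * |s.im|)) * (π / (Real.exp (π * |s.im|) / 4)) := by
        have := Real.pi_pos
        exact mul_le_mul hg (by gcongr) (by positivity) ((norm_nonneg _).trans hg)
    _ = 4 * π * K * (Real.exp ((π - δ) * |s.im|) / Real.exp (π * |s.im|)) := by
        field_simp
    _ = _ := by
        rw [← Real.exp_sub]
        congr 2
        ring

theorem integrable_exp_neg_mul_abs {δ : ℝ} (hδ : 0 < δ) :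
    MeasureTheory.Integrable fun y : ℝ => Real.exp (-δ * |y|) := by
  rw [← MeasureTheory.integrableOn_univ, ← Set.Iic_union_Ioi (a := (0 : ℝ))]
  refine MeasureTheory.IntegrableOn.union ?_ ?_
  · refine (integrableOn_exp_mul_Iic hδ 0).congr_fun (fun y hy => ?_) measurableSet_Iic
    simp only [abs_of_nonpos (Set.mem_Iic.1 hy)]
    ring_nf
  · refine (integrableOn_exp_mul_Ioi (neg_neg_of_pos hδ) 0).congr_fun (fun y hy => ?_)
      measurableSet_Ioi
    simp only [abs_of_pos (Set.mem_Ioi.1 hy)]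

/-- The bound does not depend on `a` and `b`, so it survives when the ends of the path go to
infinity. -/
theorem norm_sub_le_of_hasDerivAt_vertical {H f : ℂ → ℂ} {c : ℂ} {E δ : ℝ} (hδ : 0 < δ)
    (hH : ∀ y : ℝ, HasDerivAt H (f (c + y * Complex.I)) (c + y * Complex.I))
    (hf : Continuous fun y : ℝ => f (c + y * Complex.I))
    (hE : ∀ y : ℝ, ‖f (c + y * Complex.I)‖ ≤ E * Real.exp (-δ * |y|)) (a b : ℝ) :
    ‖H (c + b * Complex.I) - H (c + a * Complex.I)‖ ≤ E * ∫ y : ℝ, Real.exp (-δ * |y|) := by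
  have hd : ∀ y : ℝ, HasDerivAt (fun y : ℝ => H (c + y * Complex.I))
      (f (c + y * Complex.I) * Complex.I) y := by
    intro y
    have h1 : HasDerivAt (fun y : ℝ => c + y * Complex.I) Complex.I y := by
      simpa using ((Complex.ofRealCLM.hasDerivAt (x := y)).mul_const Complex.I).const_add c
    exact (hH y).comp y h1
  have hi : IntervalIntegrable (fun y : ℝ => f (c + y * Complex.I) * Complex.I)
      MeasureTheory.volume a b := (hf.mul continuous_const).intervalIntegrable _ _
  have hE0 : 0 ≤ E := by
    have := (norm_nonneg _).trans (hE 0)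
    simpa using this
  rw [← intervalIntegral.integral_eq_sub_of_hasDerivAt (fun y _ => hd y) hi,
    ← MeasureTheory.integral_const_mul]
  have hint := (integrable_exp_neg_mul_abs hδ).const_mul E
  calc _ ≤ ∫ y in Set.uIoc a b, ‖f (c + y * Complex.I) * Complex.I‖ :=
        intervalIntegral.norm_integral_le_integral_norm_uIoc
    _ ≤ ∫ y in Set.uIoc a b, E * Real.exp (-δ * |y|) := by
        refine MeasureTheory.setIntegral_mono hi.def'.norm hint.integrableOn fun y => ?_
        simpa using hE y
    _ ≤ _ := by
        refine MeasureTheory.setIntegral_le_integral hint (Eventually.of_forall fun y => ?_)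
        exact mul_nonneg hE0 (Real.exp_pos _).le

theorem norm_sub_le_of_hasDerivAt_horizontal {H f : ℂ → ℂ} {R C : ℝ} {s s' : ℂ}
    (him : s.im = s'.im) (hs : |s.re| ≤ R) (hs' : |s'.re| ≤ R)
    (hH : ∀ z : ℂ, z.im = s.im → |z.re| ≤ R → HasDerivAt H (f z) z)
    (hC : ∀ z : ℂ, z.im = s.im → |z.re| ≤ R → ‖f z‖ ≤ C) :
    ‖H s - H s'‖ ≤ C * (2 * R) := by
  set U : Set ℂ := Complex.re ⁻¹' Set.Icc (-R) R ∩ Complex.im ⁻¹' {s.im}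
  have hU : Convex ℝ U := ((convex_Icc _ _).linear_preimage Complex.reLm).inter
    ((convex_singleton _).linear_preimage Complex.imLm)
  have hC0 : 0 ≤ C := (norm_nonneg _).trans (hC s rfl hs)
  have h := hU.norm_image_sub_le_of_norm_hasDerivWithin_le (f := H) (f' := f) (C := C)
    (fun z hz => (hH z hz.2 (abs_le.2 hz.1)).hasDerivWithinAt)
    (fun z hz => hC z hz.2 (abs_le.2 hz.1)) (x := s') (y := s)
    ⟨abs_le.1 hs', him.symm⟩ ⟨abs_le.1 hs, rfl⟩
  refine h.trans (mul_le_mul_of_nonneg_left ?_ hC0)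
  have e : s - s' = ((s.re - s'.re : ℝ) : ℂ) := by
    apply Complex.ext <;> simp [him]
  rw [e, Complex.norm_real, Real.norm_eq_abs]
  have := abs_le.1 hs
  have := abs_le.1 hs'
  rw [abs_le]
  constructor <;> linarith

/-- Evaluation of a Barnes integral by its residues at the poles on the right. -/
theorem IsBarnesPath.tendsto_integral_mul_pi_div_sin {g : ℂ → ℂ} (hg : Differentiable ℂ g)
    {γ : ℝ → ℂ} (hγ : IsBarnesPath γ) {S : ℂ} {δ : ℝ} (hδ : 0 < δ)
    (hstrip : ∀ R : ℝ, ∃ K : ℝ, ∀ s : ℂ, |s.re| ≤ R → ‖g s‖ ≤ K * Real.exp ((π - δ) * |s.im|))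
    {ε : ℕ → ℝ} (hε : Tendsto ε atTop (𝓝 0))
    (hline : ∀ᶠ N : ℕ in atTop, ∀ s : ℂ, s.re = N + 1 / 2 →
      ‖g s‖ ≤ ε N * Real.exp ((π - δ) * |s.im|))
    (hsum : HasSum (fun n : ℕ => (-1) ^ n * g n) S) :
    Tendsto (fun ab : ℝ × ℝ => ∫ t in ab.1..ab.2, g (γ t) * (π / Complex.sin (π * γ t)) * deriv γ t)
      (atBot ×ˢ atTop) (𝓝 (-(2 * π * Complex.I * S))) := by
  obtain ⟨M, hM⟩ := hγ.bounded_re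
  set I₀ := ∫ y : ℝ, Real.exp (-δ * |y|)
  rw [Metric.tendsto_nhds]
  intro e he
  -- `N` is fixed before the ends move: the vertical line and the tail of the series each cost less
  -- than `e / 3`, and the path lies in the strip |Re s| ≤ N + 1/2. The two horizontal moves to the
  -- line later cost less than `e / 6` each.
  have t₁ : ∀ᶠ N : ℕ in atTop, 4 * π * ε N * I₀ < e / 3 := by
    have := (hε.const_mul (4 * π)).mul_const I₀
    rw [mul_zero, zero_mul] at this
    exact this.eventually_lt_const (by positivity)
  have t₂ : ∀ᶠ N : ℕ in atTop,
      ‖2 * π * Complex.I * S - 2 * π * Complex.I * ∑ n ∈ Finset.range (N + 1), (-1) ^ n * g n‖ <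
        e / 3 := by
    have := ((hsum.tendsto_sum_nat.comp (tendsto_add_atTop_nat 1)).const_mul
      (2 * π * Complex.I)).const_sub (2 * π * Complex.I * S)
    rw [sub_self] at this
    have := this.norm
    rw [norm_zero] at this
    exact this.eventually_lt_const (by positivity)
  have t₃ : ∀ᶠ N : ℕ in atTop, M ≤ N := tendsto_natCast_atTop_atTop.eventually_ge_atTop M
  obtain ⟨N, hN₁, hN₂, hN₃, hN₄⟩ := (t₁.and (t₂.and (t₃.and hline))).exists
  obtain ⟨H, hH, hev⟩ := exists_primitive_and_eventually_integral_eq hg N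
  obtain ⟨K, hK⟩ := hstrip (N + 1 / 2)
  set f : ℂ → ℂ := fun s => g s * (π / Complex.sin (π * s))
  set c : ℂ := (N : ℂ) + 1 / 2
  have hcre : ∀ y : ℝ, (c + y * Complex.I).re = N + 1 / 2 := fun y => by simp [c]
  have hcim : ∀ y : ℝ, (c + y * Complex.I).im = y := fun y => by simp [c]
  have hcabs : |(N : ℝ) + 1 / 2| < N + 1 := by
    rw [abs_of_pos (by positivity)]; linarith
  have hvert : ∀ a b : ℝ, ‖H (c + b * Complex.I) - H (c + a * Complex.I)‖ < e / 3 := by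
    intro a b
    refine (norm_sub_le_of_hasDerivAt_vertical (f := f) (E := 4 * π * ε N) hδ ?_ ?_ ?_ a b).trans_lt
      hN₁
    · exact fun y => hH _ (by rw [hcre]; exact hcabs) (Or.inr (hcre y))
    · have hcc : Continuous fun y : ℝ => c + y * Complex.I := by fun_prop
      refine (hg.continuous.comp hcc).mul (continuous_const.div
        (Complex.continuous_sin.comp (continuous_const.mul hcc)) fun y h0 => ?_)
      have := Complex.norm_sin_ge_of_re_eq_half (hcre y)
      rw [h0, norm_zero] at this
      have := Real.exp_pos (π * |(c + y * Complex.I).im|)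
      linarith
    · intro y
      have := norm_mul_pi_div_sin_le (g := g) (Or.inr (hcre y)) (hN₄ _ (hcre y))
      rwa [hcim] at this
  have hhor : ∀ s : ℂ, |s.re| ≤ N + 1 / 2 → 1 ≤ |s.im| →
      ‖H s - H (c + s.im * Complex.I)‖ ≤
        4 * π * K * Real.exp (-δ * |s.im|) * (2 * (N + 1 / 2)) := by
    intro s hs him
    refine norm_sub_le_of_hasDerivAt_horizontal (f := f) (by rw [hcim]) hs
      (by rw [hcre, abs_of_pos (by positivity)]) ?_ ?_
    · intro z hz hz'
      refine hH z (hz'.trans_lt (by linarith)) (Or.inl fun h0 => ?_)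
      rw [← hz, h0] at him
      norm_num at him
    · intro z hz hz'
      rw [← hz] at him ⊢
      -- The value of `N` matters only in the other alternative of the hypothesis.
      exact norm_mul_pi_div_sin_le (g := g) (N := 0) (Or.inl him) (hK z hz')
  have hre : ∀ t, |(γ t).re| ≤ N + 1 / 2 := fun t => (hM t).trans (by linarith)
  have hdecay : Tendsto (fun y : ℝ => 4 * π * K * Real.exp (-δ * |y|) * (2 * (N + 1 / 2)))
      (cocompact ℝ) (𝓝 0) := by
    have h1 : Tendsto (fun y : ℝ => -δ * |y|) (cocompact ℝ) atBot :=
      tendsto_norm_cocompact_atTop.const_mul_atTop_of_neg (neg_neg_of_pos hδ)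
    have := ((Real.tendsto_exp_atBot.comp h1).const_mul (4 * π * K)).mul_const (2 * ((N : ℝ) + 1 / 2))
    rwa [mul_zero, zero_mul] at this
  have hsmall := hdecay.eventually_lt_const (show (0 : ℝ) < e / 6 by positivity)
  filter_upwards [hev γ hγ fun t => (hre t).trans_lt (by linarith),
    ((hγ.tendsto_bot.eventually (atBot_le_cocompact hsmall)).and
      (hγ.tendsto_bot.eventually_le_atBot (-1))).prod_mk
    ((hγ.tendsto_top.eventually (atTop_le_cocompact hsmall)).and
      (hγ.tendsto_top.eventually_ge_atTop 1))] with ab hab hab'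
  obtain ⟨⟨ha, ha'⟩, hb, hb'⟩ := hab'
  have h1 := (hhor (γ ab.1) (hre _) (by rw [le_abs]; right; linarith)).trans_lt ha
  have h2 := (hhor (γ ab.2) (hre _) (by rw [le_abs]; left; linarith)).trans_lt hb
  have h3 := hvert (γ ab.1).im (γ ab.2).im
  rw [hab, dist_eq_norm]
  set A := H (γ ab.1)
  set B := H (γ ab.2)
  set A' := H (c + (γ ab.1).im * Complex.I)
  set B' := H (c + (γ ab.2).im * Complex.I)
  calc _ = ‖(B - B') - (A - A') + (B' - A') + (2 * π * Complex.I * S -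
        2 * π * Complex.I * ∑ n ∈ Finset.range (N + 1), (-1) ^ n * g n)‖ := by
        congr 1; ring
    _ ≤ ‖B - B'‖ + ‖A - A'‖ + ‖B' - A'‖ + _ :=
        (norm_add_le _ _).trans (add_le_add_left ((norm_add_le _ _).trans
          (add_le_add_left (norm_sub_le _ _) _)) _)
    _ < e := by linarith

/-! ### Exponential bounds for Γ and 1/Γ on vertical strips -/

theorem norm_cpow_mul_cexp_neg_mul {w r : ℂ} {t : ℝ} (ht : 0 < t) :
    ‖(t : ℂ) ^ w * Complex.exp (-(r * t))‖ = t ^ w.re * Real.exp (-(r.re * t)) := by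
  rw [norm_mul, Complex.norm_cpow_eq_rpow_re_of_pos ht, Complex.norm_exp]
  simp

theorem integrableOn_rpow_mul_exp_neg_mul_Ioi {σ b : ℝ} (hσ : -1 < σ) (hb : 0 < b) :
    MeasureTheory.IntegrableOn (fun t : ℝ => t ^ σ * Real.exp (-(b * t))) (Set.Ioi 0) := by
  simpa [Real.rpow_one] using integrableOn_rpow_mul_exp_neg_mul_rpow (p := 1) hσ one_pos hb

theorem aestronglyMeasurable_cpow_mul_cexp_neg_mul (w r : ℂ) :
    MeasureTheory.AEStronglyMeasurable (fun t : ℝ => (t : ℂ) ^ w * Complex.exp (-(r * t)))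
      (MeasureTheory.volume.restrict (Set.Ioi 0)) := by
  refine ContinuousOn.aestronglyMeasurable (fun t ht => ?_) measurableSet_Ioi
  refine ContinuousAt.continuousWithinAt (ContinuousAt.mul ?_ (by fun_prop))
  exact Complex.continuousAt_ofReal_cpow_const _ _ (Or.inr (ne_of_gt ht))

theorem integrableOn_cpow_mul_cexp_neg_mul_Ioi {w r : ℂ} (hw : -1 < w.re) (hr : 0 < r.re) :
    MeasureTheory.IntegrableOn (fun t : ℝ => (t : ℂ) ^ w * Complex.exp (-(r * t))) (Set.Ioi 0) := by
  refine (integrableOn_rpow_mul_exp_neg_mul_Ioi hw hr).mono'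
    (aestronglyMeasurable_cpow_mul_cexp_neg_mul w r) ?_
  filter_upwards [MeasureTheory.ae_restrict_mem measurableSet_Ioi] with t ht
  exact (norm_cpow_mul_cexp_neg_mul ht).le

/-- Differentiation under the integral: on the ball of radius Re r / 2 the real part stays at least
Re r / 2, which gives an integrable majorant. -/
theorem differentiableAt_integral_cpow_mul_cexp_neg_mul {w r : ℂ} (hw : -1 < w.re) (hr : 0 < r.re) :
    DifferentiableAt ℂ
      (fun r : ℂ => ∫ t : ℝ in Set.Ioi 0, (t : ℂ) ^ w * Complex.exp (-(r * t))) r := by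
  have hball : ∀ x ∈ Metric.ball r (r.re / 2), r.re / 2 ≤ x.re := by
    intro x hx
    have := (Complex.abs_re_le_norm (x - r)).trans_lt (mem_ball_iff_norm.1 hx)
    rw [Complex.sub_re, abs_lt] at this
    linarith
  refine (hasDerivAt_integral_of_dominated_loc_of_deriv_le
    (F' := fun r t => (t : ℂ) ^ w * (Complex.exp (-(r * t)) * -t))
    (bound := fun t => t ^ (w.re + 1) * Real.exp (-(r.re / 2 * t)))
    (Metric.ball_mem_nhds r (half_pos hr)) ?_ ?_ ?_ ?_ ?_ ?_).2.differentiableAt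
  · exact Eventually.of_forall fun x => aestronglyMeasurable_cpow_mul_cexp_neg_mul w x
  · exact integrableOn_cpow_mul_cexp_neg_mul_Ioi hw hr
  · simp_rw [← mul_assoc]
    exact (aestronglyMeasurable_cpow_mul_cexp_neg_mul w r).mul
      (by fun_prop : Continuous fun t : ℝ => -(t : ℂ)).aestronglyMeasurable
  · filter_upwards [MeasureTheory.ae_restrict_mem measurableSet_Ioi] with t ht x hx
    have ht : 0 < t := ht
    rw [← mul_assoc, norm_mul, norm_cpow_mul_cexp_neg_mul ht, norm_neg, Complex.norm_real,
      Real.norm_of_nonneg ht.le, Real.rpow_add_one ht.ne', mul_right_comm]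
    have := hball x hx
    gcongr
  · exact integrableOn_rpow_mul_exp_neg_mul_Ioi (by linarith) (half_pos hr)
  · refine Eventually.of_forall fun t x _ => ?_
    have := (((hasDerivAt_id x).mul_const (t : ℂ)).neg.cexp).const_mul ((t : ℂ) ^ w)
    simpa using this

/-- The rotated Gamma integral. -/
theorem Complex.integral_cpow_mul_cexp_neg_mul_Ioi_eq_exp_mul_Gamma {w r : ℂ} (hw : 0 < w.re)
    (hr : 0 < r.re) :
    ∫ t : ℝ in Set.Ioi 0, (t : ℂ) ^ (w - 1) * Complex.exp (-(r * t)) =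
      Complex.exp (-(w * Complex.log r)) * Complex.Gamma w := by
  set U : Set ℂ := Complex.re ⁻¹' Set.Ioi 0
  have hU : IsOpen U := isOpen_Ioi.preimage Complex.continuous_re
  have hUc : Convex ℝ U := (convex_Ioi _).linear_preimage Complex.reLm
  have hw1 : -1 < (w - 1).re := by simpa using hw
  have ha : AnalyticOnNhd ℂ
      (fun r : ℂ => ∫ t : ℝ in Set.Ioi 0, (t : ℂ) ^ (w - 1) * Complex.exp (-(r * t))) U :=
    DifferentiableOn.analyticOnNhd (fun x hx =>
      (differentiableAt_integral_cpow_mul_cexp_neg_mul hw1 hx).differentiableWithinAt) hU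
  have hb : AnalyticOnNhd ℂ
      (fun r : ℂ => Complex.exp (-(w * Complex.log r)) * Complex.Gamma w) U := by
    refine DifferentiableOn.analyticOnNhd (fun x hx => ?_) hU
    have : x ∈ Complex.slitPlane := Or.inl hx
    exact ((((differentiableAt_id.clog this).const_mul w).neg.cexp).mul_const _).differentiableWithinAt
  have h1 : (1 : ℂ) ∈ U := by simp [U]
  -- Identity theorem: both sides are analytic in `r` on the right half-plane and agree at positive
  -- reals, which accumulate at 1.
  have hmap : Tendsto (fun x : ℝ => (x : ℂ)) (𝓝[≠] 1) (𝓝[≠] 1) := by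
    refine tendsto_nhdsWithin_of_tendsto_nhds_of_eventually_within _ ?_ ?_
    · have : Tendsto (fun x : ℝ => (x : ℂ)) (𝓝 1) (𝓝 ((1 : ℝ) : ℂ)) :=
        Complex.continuous_ofReal.tendsto 1
      rw [Complex.ofReal_one] at this
      exact this.mono_left nhdsWithin_le_nhds
    · filter_upwards [self_mem_nhdsWithin] with x hx h0
      exact hx (by exact_mod_cast (show (x : ℂ) = 1 from h0))
  refine ha.eqOn_of_preconnected_of_frequently_eq hb hUc.isPreconnected h1
    (hmap.frequently (Eventually.frequently ?_)) hr
  filter_upwards [nhdsWithin_le_nhds (lt_mem_nhds one_pos)] with x hx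
  rw [Complex.integral_cpow_mul_exp_neg_mul_Ioi hw hx]
  congr 1
  have hx0 : (x : ℂ) ≠ 0 := by exact_mod_cast hx.ne'
  rw [one_div, Complex.cpow_def_of_ne_zero (inv_ne_zero hx0), Complex.log_inv]
  · congr 1; ring
  · rw [Complex.arg_ofReal_of_nonneg hx.le]
    exact Real.pi_ne_zero.symm

/-- Rotate the Gamma integral to `r = exp (φ * I)` and take absolute values inside; the prefactor
has modulus e^{φ Im w}. -/
theorem Complex.norm_Gamma_le_mul_exp {w : ℂ} (hw : 0 < w.re) {φ : ℝ} (hφ : |φ| < π / 2) :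
    ‖Complex.Gamma w‖ ≤
      (1 / Real.cos φ) ^ w.re * Real.Gamma w.re * Real.exp (-(φ * w.im)) := by
  have hφ' := abs_lt.1 hφ
  have hcos : 0 < Real.cos φ := Real.cos_pos_of_mem_Ioo hφ'
  have hre : (Complex.exp (φ * Complex.I)).re = Real.cos φ := Complex.exp_ofReal_mul_I_re φ
  have hlog : Complex.log (Complex.exp (φ * Complex.I)) = φ * Complex.I := by
    have := Real.pi_pos
    rw [Complex.log_exp] <;> simp <;> linarith
  have h := Complex.integral_cpow_mul_cexp_neg_mul_Ioi_eq_exp_mul_Gamma hw (hre.symm ▸ hcos)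
  rw [hlog] at h
  have hn : ‖Complex.exp (-(w * (φ * Complex.I)))‖ = Real.exp (φ * w.im) := by
    rw [Complex.norm_exp]
    congr 1
    simp
    ring
  have hle : ‖∫ t : ℝ in Set.Ioi 0, (t : ℂ) ^ (w - 1) *
      Complex.exp (-(Complex.exp (φ * Complex.I) * t))‖ ≤
      ∫ t : ℝ in Set.Ioi 0, t ^ (w.re - 1) * Real.exp (-(Real.cos φ * t)) := by
    refine MeasureTheory.norm_integral_le_of_norm_le
      (integrableOn_rpow_mul_exp_neg_mul_Ioi (by linarith) hcos) ?_
    filter_upwards [MeasureTheory.ae_restrict_mem measurableSet_Ioi] with t ht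
    rw [norm_cpow_mul_cexp_neg_mul ht, hre]
    simp
  rw [h, norm_mul, hn, Real.integral_rpow_mul_exp_neg_mul_Ioi hw hcos] at hle
  rw [Real.exp_neg, ← div_eq_mul_inv, le_div_iff₀ (Real.exp_pos _), mul_comm]
  exact hle

theorem Complex.norm_Gamma_le_mul_exp_abs {w : ℂ} (hw : 0 < w.re) {φ : ℝ} (hφ0 : 0 ≤ φ)
    (hφ : φ < π / 2) :
    ‖Complex.Gamma w‖ ≤
      (1 / Real.cos φ) ^ w.re * Real.Gamma w.re * Real.exp (-(φ * |w.im|)) := by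
  rcases abs_cases w.im with ⟨h, -⟩ | ⟨h, -⟩
  · rw [h]
    exact Complex.norm_Gamma_le_mul_exp hw (by rwa [abs_of_nonneg hφ0])
  · have := Complex.norm_Gamma_le_mul_exp hw (φ := -φ) (by rwa [abs_neg, abs_of_nonneg hφ0])
    rw [Real.cos_neg] at this
    rw [h]
    convert this using 3
    ring

/-- Reflection formula. At the poles of Γ it also holds: the left side is 0 by the default value,
the right side by the sine. -/
theorem Complex.inv_Gamma_eq_of_re_lt_one {w : ℂ} (hw : w.re < 1) :
    (Complex.Gamma w)⁻¹ = Complex.Gamma (1 - w) * Complex.sin (π * w) / π := by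
  have h1 : Complex.Gamma (1 - w) ≠ 0 := Complex.Gamma_ne_zero_of_re_pos (by simpa using hw)
  rw [eq_div_of_mul_eq h1 (Complex.Gamma_mul_Gamma_one_sub w), inv_div, div_div_eq_mul_div]

theorem Complex.norm_sin_le_exp_abs_im (z : ℂ) : ‖Complex.sin z‖ ≤ Real.exp |z.im| := by
  have e : 2 * ‖Complex.sin z‖ = ‖Complex.exp (-z * Complex.I) - Complex.exp (z * Complex.I)‖ := by
    rw [Complex.sin, norm_div, norm_mul, Complex.norm_I, mul_one, Complex.norm_ofNat]
    ring
  have n1 : ‖Complex.exp (-z * Complex.I)‖ ≤ Real.exp |z.im| := by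
    simpa [Complex.norm_exp] using le_abs_self z.im
  have n2 : ‖Complex.exp (z * Complex.I)‖ ≤ Real.exp |z.im| := by
    simpa [Complex.norm_exp] using neg_le_abs z.im
  have := norm_sub_le (Complex.exp (-z * Complex.I)) (Complex.exp (z * Complex.I))
  linarith

theorem Complex.inv_Gamma_add_one {w : ℂ} (hw : w ≠ 0) :
    (Complex.Gamma (w + 1))⁻¹ = (Complex.Gamma w)⁻¹ / w := by
  rw [Complex.Gamma_add_one w hw, mul_inv]
  ring

theorem Complex.norm_inv_Gamma_add_nat_le {w : ℂ} (hw : 1 ≤ |w.im|) (m : ℕ) :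
    ‖(Complex.Gamma (w + m))⁻¹‖ ≤ ‖(Complex.Gamma w)⁻¹‖ := by
  induction m with
  | zero => simp
  | succ m ih =>
    have h1 : 1 ≤ ‖w + m‖ := by
      have := Complex.abs_im_le_norm (w + m)
      simp only [Complex.add_im, Complex.natCast_im, add_zero] at this
      exact hw.trans this
    have h0 : w + m ≠ 0 := norm_pos_iff.1 (one_pos.trans_le h1)
    rw [Nat.cast_succ, ← add_assoc, Complex.inv_Gamma_add_one h0, norm_div]
    exact (div_le_self (norm_nonneg _) h1).trans ih

theorem Complex.norm_inv_Gamma_add_nat_le_div_factorial {w : ℂ} (hw : 1 ≤ w.re) (m : ℕ) :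
    ‖(Complex.Gamma (w + m))⁻¹‖ ≤ ‖(Complex.Gamma w)⁻¹‖ / m.factorial := by
  induction m with
  | zero => simp
  | succ m ih =>
    have h1 : (m + 1 : ℝ) ≤ ‖w + m‖ := by
      have := Complex.re_le_norm (w + m)
      simp only [Complex.add_re, Complex.natCast_re] at this
      linarith
    have hm : (0 : ℝ) < m + 1 := by positivity
    have h0 : w + m ≠ 0 := norm_pos_iff.1 (hm.trans_le h1)
    rw [Nat.cast_succ, ← add_assoc, Complex.inv_Gamma_add_one h0, norm_div, Nat.factorial_succ,
      Nat.cast_mul, mul_comm (((m + 1 : ℕ)) : ℝ), ← div_div]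
    push_cast
    gcongr

/-- By reflection, the decay e^{-φ|Im w|} of Γ(1-w) meets the growth e^{π|Im w|} of the sine; the
remaining factor is continuous in Re w on a compact interval. -/
theorem Complex.exists_norm_inv_Gamma_le_of_re_le_zero (A : ℝ) {φ : ℝ} (hφ0 : 0 ≤ φ)
    (hφ : φ < π / 2) :
    ∃ K : ℝ, ∀ w : ℂ, A ≤ w.re → w.re ≤ 0 →
      ‖(Complex.Gamma w)⁻¹‖ ≤ K * Real.exp ((π - φ) * |w.im|) := by
  have hcos : 0 < Real.cos φ := Real.cos_pos_of_mem_Ioo ⟨by linarith, hφ⟩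
  have hc : ContinuousOn (fun x : ℝ => (1 / Real.cos φ) ^ x * Real.Gamma x) (Set.Icc 1 (1 - A)) := by
    intro x hx
    refine ContinuousAt.continuousWithinAt (ContinuousAt.mul ?_ ?_)
    · exact (Real.continuous_const_rpow (by positivity)).continuousAt
    · refine (Real.differentiableAt_Gamma fun m h0 => ?_).continuousAt
      have : (0 : ℝ) ≤ m := m.cast_nonneg
      linarith [hx.1]
  obtain ⟨C, hC⟩ := isCompact_Icc.bddAbove_image hc
  refine ⟨C / π, fun w hA h0 => ?_⟩
  have hre : (1 - w).re = 1 - w.re := by simp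
  have him : |(1 - w).im| = |w.im| := by simp
  have h1 := Complex.norm_Gamma_le_mul_exp_abs (w := 1 - w) (by rw [hre]; linarith) hφ0 hφ
  have h2 : (1 / Real.cos φ) ^ (1 - w).re * Real.Gamma (1 - w).re ≤ C :=
    hC ⟨_, ⟨by rw [hre]; linarith, by rw [hre]; linarith⟩, rfl⟩
  have h3 := Complex.norm_sin_le_exp_abs_im (π * w)
  rw [Complex.im_ofReal_mul, abs_mul, abs_of_pos Real.pi_pos] at h3
  have h4 := h1.trans (mul_le_mul_of_nonneg_right h2 (Real.exp_pos _).le)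
  rw [him] at h4
  rw [Complex.inv_Gamma_eq_of_re_lt_one (by linarith), norm_div, norm_mul, Complex.norm_real,
    Real.norm_of_nonneg Real.pi_pos.le, div_mul_eq_mul_div]
  have e : Real.exp ((π - φ) * |w.im|) = Real.exp (-(φ * |w.im|)) * Real.exp (π * |w.im|) := by
    rw [← Real.exp_add]; congr 1; ring
  rw [e, ← mul_assoc]
  have := Real.pi_pos
  have := (norm_nonneg _).trans h4
  gcongr

/-- For |Im w| ≥ 1, shifting from `w - m` to `w` divides 1/Γ by factors of modulus at least 1, which
reduces to Re w ≤ 0. The rest of the strip is a compact rectangle. -/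
theorem Complex.exists_norm_inv_Gamma_le (A B : ℝ) {φ : ℝ} (hφ0 : 0 ≤ φ) (hφ : φ < π / 2) :
    ∃ K : ℝ, ∀ w : ℂ, A ≤ w.re → w.re ≤ B →
      ‖(Complex.Gamma w)⁻¹‖ ≤ K * Real.exp ((π - φ) * |w.im|) := by
  obtain ⟨m, hm⟩ := exists_nat_ge B
  obtain ⟨K₁, hK₁⟩ := Complex.exists_norm_inv_Gamma_le_of_re_le_zero (A - m) hφ0 hφ
  have hcomp : IsCompact (Set.Icc A B ×ℂ Set.Icc (-1) 1) := isCompact_Icc.reProdIm isCompact_Icc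
  obtain ⟨K₂, hK₂⟩ := hcomp.exists_bound_of_continuousOn
    Complex.differentiable_one_div_Gamma.continuous.continuousOn
  refine ⟨max K₁ K₂, fun w hA hB => ?_⟩
  rcases le_total 1 |w.im| with h | h
  · have h1 := Complex.norm_inv_Gamma_add_nat_le (w := w - m) (by simpa using h) m
    rw [sub_add_cancel] at h1
    have h2 := hK₁ (w - m) (by simpa using hA) (by simp; linarith)
    rw [show (w - m).im = w.im by simp] at h2
    refine (h1.trans h2).trans ?_
    gcongr
    exact le_max_left _ _
  · have h1 := hK₂ w ⟨⟨hA, hB⟩, abs_le.1 h⟩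
    have h0 : 0 ≤ K₂ := (norm_nonneg _).trans h1
    refine h1.trans ((le_max_right K₁ K₂).trans ?_)
    refine le_mul_of_one_le_right (h0.trans (le_max_right _ _)) (Real.one_le_exp ?_)
    have := Real.pi_pos
    exact mul_nonneg (by linarith) (abs_nonneg _)

/-! ### The scalar Miller-Ross integral -/

/-- `x ^ s / Γ(v + 1 + s)`, with the principal power. -/
noncomputable def Complex.cpowDivGamma (v x s : ℂ) : ℂ :=
  Complex.exp (s * Complex.log x) * (Complex.Gamma (v + 1 + s))⁻¹

namespace Complex

theorem differentiable_cpowDivGamma (v x : ℂ) : Differentiable ℂ (cpowDivGamma v x) := by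
  have h : Differentiable ℂ fun s : ℂ => (Gamma (v + 1 + s))⁻¹ :=
    differentiable_one_div_Gamma.comp (differentiable_id.const_add _)
  exact (differentiable_id.mul_const _).cexp.mul h

/-- A shift by `m` multiplies the power by x^m and 1/Γ by at most 1/m!. This yields both the
convergence of the series and the decay on the lines Re s = N + 1/2. -/
theorem norm_cpowDivGamma_add_nat_le {v x s : ℂ} (hx : x ≠ 0) (hs : 1 ≤ (v + 1 + s).re) (m : ℕ) :
    ‖cpowDivGamma v x (s + m)‖ ≤ ‖x‖ ^ m / m.factorial * ‖cpowDivGamma v x s‖ := by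
  have e : exp ((s + m) * log x) = exp (s * log x) * x ^ m := by
    rw [add_mul, exp_add, exp_nat_mul, exp_log hx]
  have h := norm_inv_Gamma_add_nat_le_div_factorial hs m
  rw [cpowDivGamma, cpowDivGamma, e, ← add_assoc, norm_mul, norm_mul, norm_pow, norm_mul]
  calc _ ≤ ‖exp (s * log x)‖ * ‖x‖ ^ m * (‖(Gamma (v + 1 + s))⁻¹‖ / m.factorial) := by gcongr
    _ = _ := by ring

theorem summable_neg_one_pow_mul_cpowDivGamma (v : ℂ) {x : ℂ} (hx : x ≠ 0) :
    Summable fun n : ℕ => (-1) ^ n * cpowDivGamma v x n := by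
  obtain ⟨N₀, hN₀⟩ := exists_nat_ge (-v.re)
  rw [← summable_nat_add_iff N₀]
  refine Summable.of_norm_bounded
    ((Real.summable_pow_div_factorial ‖x‖).mul_right ‖cpowDivGamma v x N₀‖) fun n => ?_
  rw [norm_mul, norm_pow, norm_neg, norm_one, one_pow, one_mul, Nat.cast_add, add_comm]
  exact norm_cpowDivGamma_add_nat_le hx (by simp; linarith) n

theorem exists_norm_cpowDivGamma_le (v : ℂ) {x : ℂ} (hx : 0 < x.re) (R : ℝ) :
    ∃ K : ℝ, ∀ s : ℂ, |s.re| ≤ R →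
      ‖cpowDivGamma v x s‖ ≤ K * Real.exp ((π - (π / 2 - |arg x|) / 2) * |s.im|) := by
  have harg : |arg x| < π / 2 := abs_arg_lt_pi_div_two_iff.2 (Or.inl hx)
  have h0 := abs_nonneg (arg x)
  -- The midpoint of |arg x| and π/2: it is an admissible angle, and |arg x| + (π - φ) is the
  -- required exponent.
  set φ : ℝ := (π / 2 + |arg x|) / 2 with hφ
  obtain ⟨K, hK⟩ := exists_norm_inv_Gamma_le (v.re + 1 - R) (v.re + 1 + R) (φ := φ)
    (by positivity) (by rw [hφ]; linarith)
  refine ⟨Real.exp (R * |Real.log ‖x‖|) * (K * Real.exp ((π - φ) * |v.im|)), fun s hs => ?_⟩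
  have hs' := abs_le.1 hs
  have h1 := hK (v + 1 + s) (by simp; linarith) (by simp; linarith)
  have hK0 : 0 ≤ K := by
    have := (norm_nonneg _).trans h1
    exact nonneg_of_mul_nonneg_left this (Real.exp_pos _)
  have h2 : |(v + 1 + s).im| ≤ |v.im| + |s.im| := by
    simpa using abs_add_le v.im s.im
  have hφπ : 0 ≤ π - φ := by rw [hφ]; linarith [Real.pi_pos]
  have h3 : ‖exp (s * log x)‖ ≤ Real.exp (R * |Real.log ‖x‖|) * Real.exp (|arg x| * |s.im|) := by
    rw [norm_exp, ← Real.exp_add, Real.exp_le_exp, mul_re, log_re, log_im]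
    have a1 : s.re * Real.log ‖x‖ ≤ R * |Real.log ‖x‖| := by
      refine (le_abs_self _).trans ?_
      rw [abs_mul]
      gcongr
    have a2 : -(s.im * arg x) ≤ |arg x| * |s.im| := by
      refine (neg_le_abs _).trans ?_
      rw [abs_mul, mul_comm]
    linarith
  rw [cpowDivGamma, norm_mul]
  calc _ ≤ (Real.exp (R * |Real.log ‖x‖|) * Real.exp (|arg x| * |s.im|)) *
        (K * Real.exp ((π - φ) * (|v.im| + |s.im|))) := by
        gcongr
        exact h1.trans (by gcongr)
    _ = Real.exp (R * |Real.log ‖x‖|) * (K * Real.exp ((π - φ) * |v.im|)) *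
        (Real.exp (|arg x| * |s.im|) * Real.exp ((π - φ) * |s.im|)) := by
        rw [mul_add, Real.exp_add]; ring
    _ = _ := by
        rw [← Real.exp_add]
        congr 2
        rw [hφ]; ring

end Complex

/-- The scalar Barnes integral of `x ^ s Γ(-s) Γ(1 + s) / Γ(v + 1 + s)`. -/
theorem IsBarnesPath.tendsto_integral_cpowDivGamma {γ : ℝ → ℂ} (hγ : IsBarnesPath γ) (v : ℂ) {x : ℂ}
    (hx : 0 < x.re) :
    Tendsto (fun ab : ℝ × ℝ => ∫ t in ab.1..ab.2,
        Complex.cpowDivGamma v x (γ t) * (π / Complex.sin (π * γ t)) * deriv γ t)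
      (atBot ×ˢ atTop)
      (𝓝 (-(2 * π * Complex.I * ∑' n : ℕ, (-1) ^ n * Complex.cpowDivGamma v x n))) := by
  have hx0 : x ≠ 0 := fun h => by simp [h] at hx
  have harg : |Complex.arg x| < π / 2 := Complex.abs_arg_lt_pi_div_two_iff.2 (Or.inl hx)
  obtain ⟨N₀, hN₀⟩ := exists_nat_ge (-v.re)
  -- `K` controls the base line Re s = N₀ + 1/2, where Re(v+1+s) ≥ 1; the line for `N` is reached by
  -- the shift `N - N₀`.
  obtain ⟨K, hK⟩ := Complex.exists_norm_cpowDivGamma_le v hx (N₀ + 1 / 2)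
  refine hγ.tendsto_integral_mul_pi_div_sin (Complex.differentiable_cpowDivGamma v x)
    (δ := (π / 2 - |Complex.arg x|) / 2) (by linarith) (Complex.exists_norm_cpowDivGamma_le v hx)
    (ε := fun N => ‖x‖ ^ (N - N₀) / (N - N₀).factorial * K) ?_ ?_
    (Complex.summable_neg_one_pow_mul_cpowDivGamma v hx0).hasSum
  · have := ((FloorSemiring.tendsto_pow_div_factorial_atTop ‖x‖).comp
      (tendsto_sub_atTop_nat N₀)).mul_const K
    rwa [zero_mul] at this
  · filter_upwards [eventually_ge_atTop N₀] with N hN s hs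
    obtain ⟨m, rfl⟩ := Nat.exists_eq_add_of_le hN
    push_cast at hs
    have hre : (s - m).re = N₀ + 1 / 2 := by simp; linarith
    have h1 := hK (s - m) (by rw [hre, abs_of_pos (by positivity)])
    rw [show (s - m).im = s.im by simp] at h1
    have h2 := Complex.norm_cpowDivGamma_add_nat_le (v := v) (s := s - m) hx0
      (by simp only [Complex.add_re, hre, Complex.one_re]; linarith) m
    rw [sub_add_cancel] at h2
    rw [Nat.add_sub_cancel_left, mul_assoc]
    exact h2.trans (by gcongr)

theorem Complex.Gamma_neg_mul_Gamma_one_add (s : ℂ) :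
    Complex.Gamma (-s) * Complex.Gamma (1 + s) = -(π / Complex.sin (π * s)) := by
  have := Complex.Gamma_mul_Gamma_one_sub (-s)
  rwa [sub_neg_eq_add, mul_neg, Complex.sin_neg, div_neg] at this

/-- The integrand of the scalar Miller-Ross integral, for given branches of the logarithms. -/
noncomputable def Complex.millerRossIntegrand (lc lz v s : ℂ) : ℂ :=
  Complex.exp (s * lc) * Complex.exp ((v + s) * lz) * Complex.Gamma (-s) * Complex.Gamma (1 + s) *
    (Complex.Gamma (v + 1 + s))⁻¹

/-- Compatibility of the branches makes the combined power of `x` principal, so that its growth is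
governed by the principal argument. -/
theorem Complex.millerRossIntegrand_eq {lc lz v x : ℂ} (h : lc + lz = Complex.log x) (s : ℂ) :
    Complex.millerRossIntegrand lc lz v s =
      -Complex.exp (v * lz) * (Complex.cpowDivGamma v x s * (π / Complex.sin (π * s))) := by
  have e : Complex.exp (s * lc) * Complex.exp ((v + s) * lz) =
      Complex.exp (v * lz) * Complex.exp (s * Complex.log x) := by
    rw [← h, ← Complex.exp_add, ← Complex.exp_add]
    congr 1
    ring
  rw [millerRossIntegrand, e, mul_assoc (_ * _) (Complex.Gamma (-s)), Gamma_neg_mul_Gamma_one_add,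
    cpowDivGamma]
  ring

theorem Complex.neg_one_pow_mul_cpowDivGamma {y : ℂ} (hy : y ≠ 0) (v : ℂ) (n : ℕ) :
    (-1) ^ n * Complex.cpowDivGamma v (-y) n = y ^ n * (Complex.Gamma (v + n + 1))⁻¹ := by
  rw [cpowDivGamma, Complex.exp_nat_mul, Complex.exp_log (neg_ne_zero.2 hy), ← mul_assoc, ← mul_pow,
    neg_one_mul, neg_neg, add_right_comm]

theorem Complex.summable_pow_mul_inv_Gamma {y : ℂ} (hy : y ≠ 0) (v : ℂ) :
    Summable fun n : ℕ => y ^ n * (Complex.Gamma (v + n + 1))⁻¹ :=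
  (Complex.summable_neg_one_pow_mul_cpowDivGamma v (neg_ne_zero.2 hy)).congr
    (Complex.neg_one_pow_mul_cpowDivGamma hy v)

theorem IsBarnesPath.tendsto_integral_millerRossIntegrand {γ : ℝ → ℂ} (hγ : IsBarnesPath γ)
    {lc lz y : ℂ} (v : ℂ) (hy : y.re < 0) (h : lc + lz = Complex.log (-y)) :
    Tendsto (fun ab : ℝ × ℝ => ∫ t in ab.1..ab.2,
        Complex.millerRossIntegrand lc lz v (γ t) * deriv γ t) (atBot ×ˢ atTop)
      (𝓝 (2 * π * Complex.I *
        (Complex.exp (v * lz) * ∑' n : ℕ, y ^ n * (Complex.Gamma (v + n + 1))⁻¹))) := by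
  have hy0 : y ≠ 0 := fun h => by simp [h] at hy
  have h1 := (hγ.tendsto_integral_cpowDivGamma v (x := -y) (by simpa using hy)).const_mul
    (-Complex.exp (v * lz))
  simp_rw [Complex.neg_one_pow_mul_cpowDivGamma hy0] at h1
  convert h1 using 2
  · rw [← intervalIntegral.integral_const_mul]
    simp_rw [Complex.millerRossIntegrand_eq h, mul_assoc]
  · ring

theorem IsBarnesPath.intervalIntegrable_millerRossIntegrand {γ : ℝ → ℂ} (hγ : IsBarnesPath γ)
    {lc lz x : ℂ} (v : ℂ) (h : lc + lz = Complex.log x) (a b : ℝ) :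
    IntervalIntegrable (fun t => Complex.millerRossIntegrand lc lz v (γ t) * deriv γ t)
      MeasureTheory.volume a b := by
  refine hγ.piecewiseC1.intervalIntegrable_comp_mul_deriv (f := Complex.millerRossIntegrand lc lz v)
    (Continuous.continuousOn ?_)
  simp_rw [Complex.millerRossIntegrand_eq h]
  have hc := hγ.piecewiseC1.1
  exact continuous_const.mul (((Complex.differentiable_cpowDivGamma v x).continuous.comp hc).mul
    (continuous_const.div (Complex.continuous_sin.comp (continuous_const.mul hc))
      fun t => Complex.sin_pi_mul_ne_zero (hγ.ne_intCast t)))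

/-! ### Reduction to idempotent components -/

namespace Bicomplex

theorem continuous_proj₁ : Continuous proj₁ :=
  AddMonoidHomClass.continuous_of_bound proj₁ 1 fun W => by
    rw [one_mul]; exact le_max_left ‖proj₁ W‖ ‖proj₂ W‖

theorem continuous_proj₂ : Continuous proj₂ :=
  AddMonoidHomClass.continuous_of_bound proj₂ 1 fun W => by
    rw [one_mul]; exact le_max_right ‖proj₁ W‖ ‖proj₂ W‖

theorem ext_proj {W W' : Bicomplex} (h₁ : proj₁ W = proj₁ W') (h₂ : proj₂ W = proj₂ W') :
    W = W' := by
  rw [← ofIdem_proj W, ← ofIdem_proj W', h₁, h₂]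

instance : CompleteSpace Bicomplex :=
  haveI : FiniteDimensional ℂ Bicomplex :=
    FiniteDimensional.of_injective toProd.toLinearMap toProd_injective
  FiniteDimensional.complete ℂ Bicomplex

noncomputable instance : NormedAlgebra ℂ Bicomplex where
  norm_smul_le := norm_smul_le

/-- A continuous algebra homomorphism commutes with the exponential series. -/
theorem proj₁_exp (W : Bicomplex) : proj₁ (NormedSpace.exp W) = Complex.exp (proj₁ W) := by
  rw [Complex.exp_eq_exp_ℂ]
  exact NormedSpace.map_exp_of_mem_ball (𝕂 := ℂ) proj₁ continuous_proj₁ W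
    ((NormedSpace.expSeries_radius_eq_top ℂ Bicomplex).symm ▸ edist_lt_top _ _)

theorem proj₂_exp (W : Bicomplex) : proj₂ (NormedSpace.exp W) = Complex.exp (proj₂ W) := by
  rw [Complex.exp_eq_exp_ℂ]
  exact NormedSpace.map_exp_of_mem_ball (𝕂 := ℂ) proj₂ continuous_proj₂ W
    ((NormedSpace.expSeries_radius_eq_top ℂ Bicomplex).symm ▸ edist_lt_top _ _)

theorem proj₁_inv (W : Bicomplex) : proj₁ W⁻¹ = (proj₁ W)⁻¹ := proj₁_ofIdem _ _

theorem proj₂_inv (W : Bicomplex) : proj₂ W⁻¹ = (proj₂ W)⁻¹ := proj₂_ofIdem _ _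

theorem hasDerivAt_of_proj {Ω : ℝ → Bicomplex} {t : ℝ} {d₁ d₂ : ℂ}
    (h₁ : HasDerivAt (fun t => proj₁ (Ω t)) d₁ t) (h₂ : HasDerivAt (fun t => proj₂ (Ω t)) d₂ t) :
    HasDerivAt Ω (ofIdem d₁ d₂) t := by
  have := (h₁.smul_const e₁).add (h₂.smul_const e₂)
  refine this.congr_of_eventuallyEq (Eventually.of_forall fun s => ?_)
  exact (ofIdem_proj (Ω s)).symm

theorem hasPathIntegral_of_proj {f : Bicomplex → Bicomplex} {f₁ f₂ : ℂ → ℂ} {Ω : ℝ → Bicomplex}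
    {J : Bicomplex} (hf₁ : ∀ W, proj₁ (f W) = f₁ (proj₁ W)) (hf₂ : ∀ W, proj₂ (f W) = f₂ (proj₂ W))
    (hΩ₁ : IsPiecewiseC1 fun t => proj₁ (Ω t)) (hΩ₂ : IsPiecewiseC1 fun t => proj₂ (Ω t))
    (hi₁ : ∀ a b, IntervalIntegrable (fun t => f₁ (proj₁ (Ω t)) * deriv (fun t => proj₁ (Ω t)) t)
      MeasureTheory.volume a b)
    (hi₂ : ∀ a b, IntervalIntegrable (fun t => f₂ (proj₂ (Ω t)) * deriv (fun t => proj₂ (Ω t)) t)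
      MeasureTheory.volume a b)
    (h₁ : Tendsto (fun p : ℝ × ℝ => ∫ t in p.1..p.2,
      f₁ (proj₁ (Ω t)) * deriv (fun t => proj₁ (Ω t)) t) (atBot ×ˢ atTop) (𝓝 (proj₁ J)))
    (h₂ : Tendsto (fun p : ℝ × ℝ => ∫ t in p.1..p.2,
      f₂ (proj₂ (Ω t)) * deriv (fun t => proj₂ (Ω t)) t) (atBot ×ˢ atTop) (𝓝 (proj₂ J))) :
    HasPathIntegral f Ω J := by
  obtain ⟨B₁, hB₁, hd₁, -⟩ := hΩ₁.exists_contDiffOn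
  obtain ⟨B₂, hB₂, hd₂, -⟩ := hΩ₂.exists_contDiffOn
  have hlim := (h₁.smul_const e₁).add (h₂.smul_const e₂)
  rw [show proj₁ J • e₁ + proj₂ J • e₂ = J from ofIdem_proj J] at hlim
  refine hlim.congr fun p => ?_
  rw [← intervalIntegral.integral_smul_const, ← intervalIntegral.integral_smul_const,
    ← intervalIntegral.integral_add (intervalIntegrable_iff.2 ((hi₁ p.1 p.2).def'.smul_const e₁))
      (intervalIntegrable_iff.2 ((hi₂ p.1 p.2).def'.smul_const e₂))]
  refine intervalIntegral.integral_congr_ae ?_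
  -- The derivative of `Ω` is taken componentwise only away from the break points of both
  -- components, a countable and hence null set.
  filter_upwards [(hB₁.union hB₂).ae_notMem MeasureTheory.volume] with t ht _
  rw [Set.mem_union, not_or] at ht
  rw [(hasDerivAt_of_proj (hd₁ t ht.1).hasDerivAt (hd₂ t ht.2).hasDerivAt).deriv]
  refine ext_proj ?_ ?_
  · rw [map_mul, proj₁_ofIdem, hf₁]
    exact proj₁_ofIdem _ _
  · rw [map_mul, proj₂_ofIdem, hf₂]
    exact proj₂_ofIdem _ _

theorem hasSum_of_proj {f : ℕ → Bicomplex} {a₁ a₂ : ℂ} (h₁ : HasSum (fun n => proj₁ (f n)) a₁)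
    (h₂ : HasSum (fun n => proj₂ (f n)) a₂) : HasSum f (ofIdem a₁ a₂) := by
  have := (h₁.smul_const e₁).add (h₂.smul_const e₂)
  exact this.congr_fun fun n => (ofIdem_proj (f n)).symm

/-- Summability of both component series is what allows the `tsum` to be split. -/
theorem millerRoss_eq_ofIdem {L V C Z : Bicomplex} (h₁ : proj₁ C * proj₁ Z ≠ 0)
    (h₂ : proj₂ C * proj₂ Z ≠ 0) :
    millerRoss L V C Z = ofIdem
      (Complex.exp (proj₁ V * proj₁ L) *
        ∑' r : ℕ, (proj₁ C * proj₁ Z) ^ r * (Complex.Gamma (proj₁ V + r + 1))⁻¹)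
      (Complex.exp (proj₂ V * proj₂ L) *
        ∑' r : ℕ, (proj₂ C * proj₂ Z) ^ r * (Complex.Gamma (proj₂ V + r + 1))⁻¹) := by
  have hs := hasSum_of_proj
    (f := fun r : ℕ => (C * Z) ^ r * (Gamma (V + (r : Bicomplex) + 1))⁻¹)
    (by simpa [proj₁_inv, Gamma, proj₁_ofIdem] using
      (Complex.summable_pow_mul_inv_Gamma h₁ (proj₁ V)).hasSum)
    (by simpa [proj₂_inv, Gamma, proj₂_ofIdem] using
      (Complex.summable_pow_mul_inv_Gamma h₂ (proj₂ V)).hasSum)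
  rw [millerRoss, hs.tsum_eq, powOfLog]
  refine ext_proj ?_ ?_
  · rw [map_mul, proj₁_ofIdem, proj₁_ofIdem, proj₁_exp, map_mul]
  · rw [map_mul, proj₂_ofIdem, proj₂_ofIdem, proj₂_exp, map_mul]

end Bicomplex

theorem mainTheorem5
    (V C Z : Bicomplex)
    (h₁ : (Bicomplex.proj₁ C * Bicomplex.proj₁ Z).re < 0)
    (h₂ : (Bicomplex.proj₂ C * Bicomplex.proj₂ Z).re < 0)
    (logZ logNegC : Bicomplex)
    (hlogZ : NormedSpace.exp logZ = Z)
    (hlogNegC : NormedSpace.exp logNegC = -C)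
    (hbranch : logNegC + logZ = Bicomplex.log (-(C * Z)))
    (Ω : ℝ → Bicomplex)
    (hΩ₁ : IsBarnesPath (fun t => Bicomplex.proj₁ (Ω t)))
    (hΩ₂ : IsBarnesPath (fun t => Bicomplex.proj₂ (Ω t))) :
    Bicomplex.HasPathIntegral
      (fun s => Bicomplex.powOfLog logNegC s * Bicomplex.powOfLog logZ (V + s) *
        Bicomplex.Gamma (-s) * Bicomplex.Gamma (1 + s) * (Bicomplex.Gamma (V + 1 + s))⁻¹)
      Ω ((2 * (π : ℂ) * Complex.I) • Bicomplex.millerRoss logZ V C Z) := by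
  have hb₁ := congrArg Bicomplex.proj₁ hbranch
  have hb₂ := congrArg Bicomplex.proj₂ hbranch
  rw [Bicomplex.log, map_add, Bicomplex.proj₁_ofIdem, map_neg, map_mul] at hb₁
  rw [Bicomplex.log, map_add, Bicomplex.proj₂_ofIdem, map_neg, map_mul] at hb₂
  have hne : ∀ {y : ℂ}, y.re < 0 → y ≠ 0 := fun hy h => by simp [h] at hy
  rw [Bicomplex.millerRoss_eq_ofIdem (hne h₁) (hne h₂)]
  refine Bicomplex.hasPathIntegral_of_proj
    (f₁ := Complex.millerRossIntegrand (Bicomplex.proj₁ logNegC) (Bicomplex.proj₁ logZ)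
      (Bicomplex.proj₁ V))
    (f₂ := Complex.millerRossIntegrand (Bicomplex.proj₂ logNegC) (Bicomplex.proj₂ logZ)
      (Bicomplex.proj₂ V))
    (fun W => ?_) (fun W => ?_) hΩ₁.piecewiseC1 hΩ₂.piecewiseC1
    (hΩ₁.intervalIntegrable_millerRossIntegrand _ hb₁)
    (hΩ₂.intervalIntegrable_millerRossIntegrand _ hb₂) ?_ ?_
  · simp only [Complex.millerRossIntegrand, Bicomplex.powOfLog, Bicomplex.Gamma, map_mul,
      Bicomplex.proj₁_inv, Bicomplex.proj₁_exp, Bicomplex.proj₁_ofIdem, map_add, map_neg, map_one]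
  · simp only [Complex.millerRossIntegrand, Bicomplex.powOfLog, Bicomplex.Gamma, map_mul,
      Bicomplex.proj₂_inv, Bicomplex.proj₂_exp, Bicomplex.proj₂_ofIdem, map_add, map_neg, map_one]
  · rw [map_smul, Bicomplex.proj₁_ofIdem, smul_eq_mul]
    exact hΩ₁.tendsto_integral_millerRossIntegrand _ h₁ hb₁
  · rw [map_smul, Bicomplex.proj₂_ofIdem, smul_eq_mul]
    exact hΩ₂.tendsto_integral_millerRossIntegrand _ h₂ hb₂
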